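/- Let $k$ be a field of characteristic $p>0$, let $G$ be a finite group, and let $M$ be a finite-dimensional $kG$-module; tensor products are over $k$ with diagonal action, and $M^{\otimes 0}=k$ is the trivial module. For a finite-dimensional $kG$-module $X$, let $\mathrm{core}(X)$ be its largest non-projective summand (so $X\cong \mathrm{core}(X)\oplus P$ with $P$ projective and $\mathrm{core}(X)$ without nonzero projective summands), let $\Omega X$ be the kernel of a projective cover of $X$ and $\Omega^{-1}X$ the cokernel of an injective hull of $X$. The $\Omega$-orbit of a non-projective indecomposable module $N$ consists of the modules isomorphic to $\Omega^a N$ for some $a\in\mathbb Z$. Suppose that $M$ is $\Omega$-algebraic, i.e. the non-projective indecomposable summands of the modules $M^{\otimes n}$, $n\ge 0$, fall into finitely many $\Omega$-orbits. Let $s_n$ be the number of indecomposable summands of $\mathrm{core}(M^{\otimes n})$. Then: 1. The sequence $(s_n)_{n\ge 0}$ is eventually linearly recursive, with integer coefficients: there are $d\ge 0$ and $c_0,\dots,c_{d-1}\in\mathbb Z$ such that $s_{n+d}=\sum_{i=0}^{d-1}c_i\,s_{n+i}$ for all sufficiently large $n$. 2. If $p$ divides $|G|$, there is a finite system $N_1,\dots,N_r$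 of representatives, exactly one for each of these $\Omega$-orbits, that contains the trivial module $k$. 3. Let $N_1,\dots,N_r$ be any system of non-projective indecomposable modules, exactly one from each of these $\Omega$-orbits, with $N_{i_0}\cong k$ for some $i_0$. Then there is an $r\times r$ matrix $T=(t_{ij})$ with entries in $\mathbb N[\Omega^{\pm1}]$ such that for all $i$ $$\mathrm{core}(M\otimes N_i)\cong\bigoplus_{j=1}^r t_{ij}(N_j),$$ where $\big(\sum_a m_a\Omega^a\big)(N)=\bigoplus_a(\Omega^aN)^{\oplus m_a}$. For every such $T$, if $A$ is the integer matrix obtained from $T$ by setting $\Omega=1$, then for all $n\ge 0$ $$s_n=\sum_{j=1}^r (A^n)_{i_0j},$$ i.e. $s_n$ is the sum of the entries of the $i_0$-th row of $A^n$ (the row indexed by the trivial module). -/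

import Mathlib

open CategoryTheory CategoryTheory.Limits
open scoped MonoidalCategory LaurentPolynomial ZeroObject

universe u v w

noncomputable section

namespace OmegaAlg

/-- A sequence is eventually linearly recursive if one of its tails satisfies a linear
recurrence `a (n + d) = ∑ i < d, c i * a (n + i)` with constant coefficients. -/
def EventuallyLinearlyRecursive {R : Type w} [CommRing R] (a : ℕ → R) : Prop :=
  ∃ (E : LinearRecurrence R) (m : ℕ), E.IsSolution fun n => a (n + m)

section Abelian

variable {C : Type u} [Category.{v} C] [Abelian C]

attribute [local instance] Abelian.hasFiniteBiproducts

/-- `X` is (isomorphic to) a direct summand of `Y`. -/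
def IsSummand (X Y : C) : Prop :=
  ∃ Z : C, Nonempty (Y ≅ X ⊞ Z)

/-- A projective cover: an epimorphism `f` from a projective object which is essential,
i.e. no proper subobject of `P` maps onto `X`. -/
structure IsProjectiveCover {P X : C} (f : P ⟶ X) : Prop where
  projective : Projective P
  epi : Epi f
  essential : ∀ (Z : C) (g : Z ⟶ P), Epi (g ≫ f) → Epi g

/-- An injective hull: a monomorphism `f` to an injective object which is essential,
i.e. every nonzero subobject of `I` meets `X`. -/
structure IsInjectiveHull {X I : C} (f : X ⟶ I) : Prop where
  injective : Injective I
  mono : Mono f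
  essential : ∀ (Z : C) (g : I ⟶ Z), Mono (f ≫ g) → Mono g

/-- `Y ≅ Ω X`: `Y` is isomorphic to the kernel of a projective cover of `X`. -/
def IsSyzygy (Y X : C) : Prop :=
  ∃ (P : C) (f : P ⟶ X), IsProjectiveCover f ∧ Nonempty (Y ≅ kernel f)

/-- `Y ≅ Ω⁻¹ X`: `Y` is isomorphic to the cokernel of an injective hull of `X`. -/
def IsCosyzygy (Y X : C) : Prop :=
  ∃ (I : C) (f : X ⟶ I), IsInjectiveHull f ∧ Nonempty (Y ≅ cokernel f)

/-- The `n`-fold iterate, up to isomorphism, of a relation between objects. -/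
def IterateRel (R : C → C → Prop) : ℕ → C → C → Prop
  | 0, Y, X => Nonempty (Y ≅ X)
  | n + 1, Y, X => ∃ Z : C, IterateRel R n Z X ∧ R Y Z

/-- `Y ≅ Ωᵃ X` for an integer `a`. -/
def IsOmegaPow : ℤ → C → C → Prop
  | Int.ofNat n => IterateRel IsSyzygy n
  | Int.negSucc n => IterateRel IsCosyzygy (n + 1)

/-- `X` lies in the orbit of `Y` under the action of `ℤ` via `Ω`. -/
def InOmegaOrbit (X Y : C) : Prop :=
  ∃ a : ℤ, IsOmegaPow a X Y

/-- `Y ≅ t(N)` for a Laurent polynomial `t` in `Ω` with natural number coefficients: `Y` is the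
direct sum, over all exponents `a`, of as many copies of `Ωᵃ N` as the coefficient of `t` at `a`. -/
def IsLaurentApply (t : ℕ[T;T⁻¹]) (Y N : C) : Prop :=
  ∃ Z : ℤ → C, (∀ a ∈ t.coeff.support, IsOmegaPow a (Z a) N) ∧
    Nonempty (Y ≅ ⨁ fun x : (Σ a : t.coeff.support, Fin (t.coeff a)) => Z x.1)

/-- `X` is indecomposable and not projective. -/
def IsNonprojIndec (X : C) : Prop :=
  Indecomposable X ∧ ¬ Projective X

/-- `K` is a core of `X`: the largest non-projective summand, i.e. a complement of a projective
summand of `X` which itself has no nonzero projective summand. -/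
def IsCore (K X : C) : Prop :=
  (∃ P : C, Projective P ∧ Nonempty (X ≅ K ⊞ P)) ∧
    ∀ Q : C, Projective Q → IsSummand Q K → IsZero Q

/-- `X` is a direct sum of `m` indecomposable objects. -/
def HasIndecDecomposition (X : C) (m : ℕ) : Prop :=
  ∃ N : Fin m → C, (∀ i, Indecomposable (N i)) ∧ Nonempty (X ≅ ⨁ N)

/-- In a category with finite-dimensional spaces of morphisms, splitting off a nonzero summand
makes the endomorphism space smaller. -/
theorem finrank_end_add_le (k : Type w) [Field k] [Linear k C]
    [∀ X Y : C, FiniteDimensional k (X ⟶ Y)] {X Y Z : C} (e : X ≅ Y ⊞ Z) :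
    Module.finrank k (Y ⟶ Y) + Module.finrank k (Z ⟶ Z) ≤ Module.finrank k (X ⟶ X) := by
  rw [← Module.finrank_prod]
  let φ : ((Y ⟶ Y) × (Z ⟶ Z)) →ₗ[k] (X ⟶ X) :=
    { toFun := fun p => e.hom ≫ biprod.map p.1 p.2 ≫ e.inv
      map_add' := fun p q => by
        have h : biprod.map (p + q).1 (p + q).2 = biprod.map p.1 p.2 + biprod.map q.1 q.2 := by
          apply biprod.hom_ext <;> apply biprod.hom_ext' <;> simp
        rw [h]; simp
      map_smul' := fun c p => by
        have h : biprod.map (c • p).1 (c • p).2 = c • biprod.map p.1 p.2 := by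
          apply biprod.hom_ext <;> apply biprod.hom_ext' <;> simp
        rw [h]; simp }
  refine LinearMap.finrank_le_finrank_of_injective (f := φ) ?_
  intro p q h
  have h' : biprod.map p.1 p.2 = biprod.map q.1 q.2 := by
    have h2 : e.hom ≫ biprod.map p.1 p.2 ≫ e.inv = e.hom ≫ biprod.map q.1 q.2 ≫ e.inv := h
    simpa using h2
  apply Prod.ext
  · have := congrArg (fun f => biprod.inl ≫ f ≫ biprod.fst) h'
    simpa using this
  · have := congrArg (fun f => biprod.inr ≫ f ≫ biprod.snd) h'
    simpa using this

theorem finrank_end_pos (k : Type w) [Field k] [Linear k C]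
    [∀ X Y : C, FiniteDimensional k (X ⟶ Y)] {X : C} (h : ¬ IsZero X) :
    0 < Module.finrank k (X ⟶ X) := by
  rw [IsZero.iff_id_eq_zero] at h
  exact Module.finrank_pos_iff_exists_ne_zero.mpr ⟨𝟙 X, h⟩

theorem exists_isCore_aux (k : Type w) [Field k] [Linear k C]
    [∀ X Y : C, FiniteDimensional k (X ⟶ Y)] (n : ℕ) :
    ∀ X : C, Module.finrank k (X ⟶ X) < n → ∃ K : C, IsCore K X := by
  induction n with
  | zero => intro X h; omega
  | succ n ih =>
    intro X hX
    by_cases hQ : ∀ Q : C, Projective Q → IsSummand Q X → IsZero Q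
    · exact ⟨X, ⟨0, inferInstance, ⟨(isoBiprodZero (isZero_zero C))⟩⟩, hQ⟩
    · push Not at hQ
      obtain ⟨Q, hQ, ⟨Z, ⟨e⟩⟩, hne⟩ := hQ
      have h1 := finrank_end_add_le k e
      have h2 := finrank_end_pos k hne
      obtain ⟨K, ⟨P, hP, ⟨e'⟩⟩, hK⟩ := ih Z (by omega)
      refine ⟨K, ⟨P ⊞ Q, inferInstance, ⟨?_⟩⟩, hK⟩
      exact e ≪≫ biprod.braiding Q Z ≪≫ biprod.mapIso e' (Iso.refl Q) ≪≫
        biprod.associator K P Q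

theorem exists_indec_summand_aux (k : Type w) [Field k] [Linear k C]
    [∀ X Y : C, FiniteDimensional k (X ⟶ Y)] (n : ℕ) :
    ∀ X : C, Module.finrank k (X ⟶ X) < n → ¬ IsZero X →
      ∃ Y Z : C, Indecomposable Y ∧ Nonempty (X ≅ Y ⊞ Z) := by
  induction n with
  | zero => intro X h; omega
  | succ n ih =>
    intro X hX h0
    by_cases hI : Indecomposable X
    · exact ⟨X, 0, hI, ⟨(isoBiprodZero (isZero_zero C))⟩⟩
    · simp only [Indecomposable, not_and, not_forall, not_or] at hI
      obtain ⟨Y, Z, e, hY, hZ⟩ := hI h0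
      have h1 := finrank_end_add_le k e
      have h2 := finrank_end_pos k hZ
      obtain ⟨Y', Z', hI', ⟨e'⟩⟩ := ih Y (by omega) hY
      exact ⟨Y', Z' ⊞ Z, hI', ⟨e ≪≫ biprod.mapIso e' (Iso.refl Z) ≪≫
        biprod.associator Y' Z' Z⟩⟩

theorem nonempty_biproduct_cons {m : ℕ} (Y : C) (N : Fin m → C) :
    Nonempty (Y ⊞ ⨁ N ≅ ⨁ (Fin.cons Y N : Fin (m + 1) → C)) := by
  let F : Fin (m + 1) → C := Fin.cons Y N
  let b : Bicone F :=
    { pt := Y ⊞ ⨁ N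
      π := fun i => Fin.cases (motive := fun i => (Y ⊞ ⨁ N) ⟶ F i) biprod.fst
        (fun j => biprod.snd ≫ biproduct.π N j) i
      ι := fun i => Fin.cases (motive := fun i => F i ⟶ (Y ⊞ ⨁ N)) biprod.inl
        (fun j => biproduct.ι N j ≫ biprod.inr) i
      ι_π := fun i j => by
        induction i using Fin.cases with
        | zero =>
          induction j using Fin.cases with
          | zero =>
            rw [dif_pos rfl]
            change (biprod.inl : Y ⟶ Y ⊞ ⨁ N) ≫ biprod.fst = 𝟙 Y
            simp
          | succ j =>
            rw [dif_neg (Fin.succ_ne_zero j).symm]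
            change (biprod.inl : Y ⟶ Y ⊞ ⨁ N) ≫ biprod.snd ≫ biproduct.π N j = 0
            simp
        | succ i =>
          induction j using Fin.cases with
          | zero =>
            rw [dif_neg (Fin.succ_ne_zero i)]
            change (biproduct.ι N i ≫ biprod.inr) ≫ (biprod.fst : Y ⊞ ⨁ N ⟶ Y) = 0
            simp
          | succ j =>
            by_cases h : i = j
            · subst h
              rw [dif_pos rfl]
              change (biproduct.ι N i ≫ (biprod.inr : ⨁ N ⟶ Y ⊞ ⨁ N)) ≫
                biprod.snd ≫ biproduct.π N i = 𝟙 (N i)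
              simp
            · rw [dif_neg (fun h' => h (Fin.succ_injective _ h'))]
              change (biproduct.ι N i ≫ (biprod.inr : ⨁ N ⟶ Y ⊞ ⨁ N)) ≫
                biprod.snd ≫ biproduct.π N j = 0
              simp [biproduct.ι_π_ne N h] }
  have total : ∑ j, b.π j ≫ b.ι j = 𝟙 b.pt := by
    rw [Fin.sum_univ_succ]
    have h : ∑ j : Fin m, b.π j.succ ≫ b.ι j.succ =
        biprod.snd ≫ (∑ j, biproduct.π N j ≫ biproduct.ι N j) ≫ biprod.inr := by
      rw [Preadditive.sum_comp, Preadditive.comp_sum]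
      refine Finset.sum_congr rfl fun j _ => ?_
      change (biprod.snd ≫ biproduct.π N j) ≫ (biproduct.ι N j ≫ biprod.inr) = _
      simp only [Category.assoc]
    rw [h, biproduct.total, Category.id_comp]
    exact biprod.total
  exact ⟨biproduct.uniqueUpToIso F (isBilimitOfTotal b total)⟩

theorem exists_indecDecomposition_aux (k : Type w) [Field k] [Linear k C]
    [∀ X Y : C, FiniteDimensional k (X ⟶ Y)] (n : ℕ) :
    ∀ X : C, Module.finrank k (X ⟶ X) < n → ∃ m, HasIndecDecomposition X m := by
  induction n with
  | zero => intro X h; omega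
  | succ n ih =>
    intro X hX
    by_cases h0 : IsZero X
    · refine ⟨0, fun _ => 0, fun i => i.elim0, ⟨h0.iso ?_⟩⟩
      rw [IsZero.iff_id_eq_zero]
      apply biproduct.hom_ext
      intro j
      exact j.elim0
    · obtain ⟨Y, Z, hY, ⟨e⟩⟩ := exists_indec_summand_aux k _ X (Nat.lt_succ_self _) h0
      have h1 := finrank_end_add_le k e
      have h2 := finrank_end_pos k hY.1
      obtain ⟨m, N, hN, ⟨e'⟩⟩ := ih Z (by omega)
      obtain ⟨c⟩ := nonempty_biproduct_cons Y N
      refine ⟨m + 1, Fin.cons Y N, fun i => ?_,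
        ⟨e ≪≫ biprod.mapIso (Iso.refl Y) e' ≪≫ c⟩⟩
      induction i using Fin.cases with
      | zero => exact hY
      | succ i => exact hN i

end Abelian

section Rep

variable {k : Type u} [Field k] {G : Type v} [Group G]

attribute [local instance] Abelian.hasFiniteBiproducts

/-- The tensor power `M ^ ⊗ n`; the zeroth power is the trivial representation `k`. -/
def tensorPow (M : FDRep k G) : ℕ → FDRep k G
  | 0 => 𝟙_ (FDRep k G)
  | n + 1 => M ⊗ tensorPow M n

theorem exists_isCore (X : FDRep k G) : ∃ K : FDRep k G, IsCore K X :=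
  exists_isCore_aux k _ X (Nat.lt_succ_self _)

theorem exists_indecDecomposition (X : FDRep k G) : ∃ m, HasIndecDecomposition X m :=
  exists_indecDecomposition_aux k _ X (Nat.lt_succ_self _)

/-- The core of a finite-dimensional representation (well defined up to isomorphism). -/
def core (X : FDRep k G) : FDRep k G :=
  Classical.choose (exists_isCore X)

/-- The number of indecomposable summands of a finite-dimensional representation (the same for
every decomposition into indecomposables). -/
def numIndecSummands (X : FDRep k G) : ℕ :=
  Classical.choose (exists_indecDecomposition X)

/-- `s_n(M)`: the number of indecomposable summands of the core of `M ^ ⊗ n`. -/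
def coreSummandCount (M : FDRep k G) (n : ℕ) : ℕ :=
  numIndecSummands (core (tensorPow M n))

/-- `X` is a non-projective indecomposable summand of some tensor power of `M`. -/
def IsTensorPowSummand (M X : FDRep k G) : Prop :=
  IsNonprojIndec X ∧ ∃ n : ℕ, IsSummand X (tensorPow M n)

/-- `M` is Omega-algebraic: the non-projective indecomposable summands of the tensor powers of `M`
fall into finitely many `Ω`-orbits. -/
def IsOmegaAlgebraic (M : FDRep k G) : Prop :=
  ∃ (s : ℕ) (N : Fin s → FDRep k G), (∀ i, IsNonprojIndec (N i)) ∧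
    ∀ X, IsTensorPowSummand M X → ∃ i, InOmegaOrbit X (N i)

/-- `N` is a system of representatives, one for each orbit, of the `Ω`-orbits of the
non-projective indecomposable summands of the tensor powers of `M`. -/
structure IsOrbitReps (M : FDRep k G) {s : ℕ} (N : Fin s → FDRep k G) : Prop where
  nonprojIndec : ∀ i, IsNonprojIndec (N i)
  represents : ∀ i, ∃ X, IsTensorPowSummand M X ∧ InOmegaOrbit X (N i)
  distinct : ∀ i j, InOmegaOrbit (N i) (N j) → i = j
  exhaustive : ∀ X, IsTensorPowSummand M X → ∃ i, InOmegaOrbit X (N i)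

/-- `T` is a matrix of Laurent polynomials in `Ω` describing the effect of `M ⊗ -` on the orbit
representatives: `core (M ⊗ N i) ≅ ⨁ j, T i j (N j)` for all `i`. -/
def IsTensorMatrix (M : FDRep k G) {s : ℕ} (N : Fin s → FDRep k G)
    (T : Matrix (Fin s) (Fin s) ℕ[T;T⁻¹]) : Prop :=
  ∀ i, ∃ Y : Fin s → FDRep k G, (∀ j, IsLaurentApply (T i j) (Y j) (N j)) ∧
    Nonempty (core (M ⊗ N i) ≅ ⨁ Y)

/-- The integer matrix obtained from a matrix of Laurent polynomials in `Ω` by setting `Ω = 1`. -/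
def evalOne {s : ℕ} (T : Matrix (Fin s) (Fin s) ℕ[T;T⁻¹]) : Matrix (Fin s) (Fin s) ℤ :=
  T.map (LaurentPolynomial.eval₂ (Nat.castRingHom ℤ) (1 : ℤˣ))

end Rep

end OmegaAlg

end

/-! The count takes place in the set of `Ω`-orbits. Let `orbits X` be the multiset of orbits of the
non-projective indecomposable summands of `X`. It is additive, vanishes on projectives and does not
change under `Ω`, and its cardinality at `M^{⊗n}` is `s_n`.

Tensoring with `M` is exact and preserves projectives, so it carries a syzygy sequence to a syzygy
sequence (`StabSyz.tensor`). Hence `orbits (M ⊗ X)` depends additively on `orbits X` alone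
(`orbits_tensor`). In the basis of the `N_j` this additive map is the matrix `A`, because `Ω^a N_j`
lies in the orbit of `N_j` for every `a`. Starting from the trivial module, `orbits (M^{⊗n})` is row
`i₀` of `A^n` (`IsTensorMatrix.orbits_tensorPow`), and Cayley–Hamilton gives the recurrence. If `p`
does not divide `|G|`, every module is projective and `s_n = 0`.

Three facts support this. Krull–Schmidt holds in Hom-finite abelian categories, because
multiplicities are dimensions of Hom modulo the radical (`krullSchmidt_of_homFinite`).
Finite-dimensional representations form a Frobenius category, by Higman's trace criterion
(`frobenius_fdRep`). By Schanuel's lemma and its dual, `Ω` is a permutation of the classes of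
non-projective indecomposables (`omegaPerm`). -/

noncomputable section

namespace OmegaAlg

attribute [local instance] Abelian.hasFiniteBiproducts

/-! ### Fitting idempotents in finite-dimensional algebras. -/

section Algebra

open Polynomial in
/-- Fitting's lemma for an element of a finite-dimensional algebra. -/
theorem exists_fitting_idempotent (k : Type*) {A : Type*} [Field k] [Ring A] [Algebra k A]
    [FiniteDimensional k A] (a : A) :
    ∃ e b : A, e * e = e ∧ e = a * b ∧ e = b * a ∧ ∃ n : ℕ, a ^ n * (1 - e) = 0 := by
  have ha : IsIntegral k a := Algebra.IsIntegral.isIntegral a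
  obtain ⟨q, hq, hnd⟩ := exists_eq_pow_rootMultiplicity_mul_and_not_dvd (minpoly k a)
    (minpoly.ne_zero ha) 0
  set n := (minpoly k a).rootMultiplicity 0
  rw [C_0, sub_zero] at hq hnd
  have hcop : IsCoprime (X ^ (n + 1) : k[X]) q :=
    ((prime_X.irreducible.coprime_iff_not_dvd).2 hnd).pow_left
  obtain ⟨s, t, hst⟩ := hcop
  have h0 : aeval a (X ^ n * q) = 0 := by rw [← hq]; exact minpoly.aeval k a
  have h1 : 1 - aeval a (s * X ^ (n + 1)) = aeval a (t * q) := by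
    have := congrArg (aeval a) hst
    rw [map_add, map_one] at this
    rw [← this]; abel
  -- The minimal polynomial is `X ^ n * q` with `q` prime to `X`. The exponent `n + 1` in the Bézout
  -- relation guarantees a factor `a` in `e`, even for `n = 0`.
  refine ⟨aeval a (s * X ^ (n + 1)), aeval a (s * X ^ n), ?_, ?_, ?_, n, ?_⟩
  · have h2 : aeval a (s * X ^ (n + 1)) * (1 - aeval a (s * X ^ (n + 1))) = 0 := by
      rw [h1, ← map_mul, show s * X ^ (n + 1) * (t * q) = s * X * t * (X ^ n * q) by ring,
        map_mul, h0, mul_zero]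
    rw [mul_sub, mul_one, sub_eq_zero] at h2
    exact h2.symm
  · rw [show s * X ^ (n + 1) = X * (s * X ^ n) by ring, map_mul, aeval_X]
  · rw [show s * X ^ (n + 1) = (s * X ^ n) * X by ring, map_mul, aeval_X]
  · rw [h1, ← aeval_X_pow (R := k), ← map_mul,
      show X ^ n * (t * q) = t * (X ^ n * q) by ring, map_mul, h0, mul_zero]

end Algebra

/-! ### Retracts and direct summands. -/

section Summands

variable {C : Type u} [Category.{v} C] [Abelian C]

/-- A retract has a complement. -/
theorem exists_biprod_of_retract {X Y : C} (i : Y ⟶ X) (r : X ⟶ Y) (h : i ≫ r = 𝟙 Y) :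
    ∃ (Z : C) (e : X ≅ Y ⊞ Z), e.hom ≫ biprod.fst = r ∧ biprod.inl ≫ e.inv = i := by
  have hidem : (𝟙 X - r ≫ i) ≫ (𝟙 X - r ≫ i) = 𝟙 X - r ≫ i := by
    simp [Preadditive.sub_comp, Preadditive.comp_sub, reassoc_of% h]
  obtain ⟨Z, j, q, hjq, hqj⟩ := IsIdempotentComplete.idempotents_split X _ hidem
  have : IsSplitMono j := ⟨⟨q, hjq⟩⟩
  have : IsSplitEpi q := ⟨⟨j, hjq⟩⟩
  have hiq : i ≫ q = 0 := by
    rw [← cancel_mono j, Category.assoc, hqj]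
    simp [Preadditive.comp_sub, reassoc_of% h]
  have hjr : j ≫ r = 0 := by
    rw [← cancel_epi q, ← Category.assoc, hqj]
    simp [Preadditive.sub_comp, h]
  refine ⟨Z, ⟨biprod.lift r q, biprod.desc i j, ?_, ?_⟩, by simp, by simp⟩
  · rw [biprod.lift_desc, hqj]; abel
  · apply biprod.hom_ext <;> apply biprod.hom_ext' <;> simp [h, hjq, hiq, hjr]

theorem isSummand_of_retract {X Y : C} (i : Y ⟶ X) (r : X ⟶ Y) (h : i ≫ r = 𝟙 Y) :
    IsSummand Y X := by
  obtain ⟨Z, e, -⟩ := exists_biprod_of_retract i r h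
  exact ⟨Z, ⟨e⟩⟩

theorem IsSummand.exists_retract {X Y : C} (h : IsSummand Y X) :
    ∃ (i : Y ⟶ X) (r : X ⟶ Y), i ≫ r = 𝟙 Y := by
  obtain ⟨Z, ⟨e⟩⟩ := h
  exact ⟨biprod.inl ≫ e.inv, e.hom ≫ biprod.fst, by simp⟩

theorem indecomposable_of_iso {X Y : C} (e : X ≅ Y) (h : Indecomposable X) :
    Indecomposable Y :=
  ⟨fun hY => h.1 (hY.of_iso e), fun A B e' => h.2 A B (e ≪≫ e')⟩

/-- A nonzero retract of an indecomposable object is everything. -/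
theorem isIso_of_retract_of_indecomposable {X Y : C} (hX : Indecomposable X) (hY : ¬ IsZero Y)
    (i : Y ⟶ X) (r : X ⟶ Y) (h : i ≫ r = 𝟙 Y) : IsIso r := by
  obtain ⟨Z, e, he, -⟩ := exists_biprod_of_retract i r h
  have hZ := (hX.2 _ _ e).resolve_left hY
  have : IsIso (biprod.fst : Y ⊞ Z ⟶ Y) :=
    ⟨biprod.inl, by
      apply biprod.hom_ext'
      · simp
      · exact hZ.eq_of_src _ _, by simp⟩
  rw [← he]
  infer_instance

theorem projective_of_isSummand {P Q : C} (hP : Projective P) (h : IsSummand Q P) :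
    Projective Q := by
  obtain ⟨i, r, hir⟩ := h.exists_retract
  exact Retract.projective ⟨i, r, hir⟩

theorem isNonprojIndec_of_iso {X Y : C} (e : X ≅ Y) (h : IsNonprojIndec X) : IsNonprojIndec Y :=
  ⟨indecomposable_of_iso e h.1, fun hY => h.2 (Projective.of_iso e.symm hY)⟩

/-- An iso-invariant additive function takes finite direct sums to sums. -/
theorem map_biproduct_eq_sum {A : Type*} [AddCommMonoid A] (Φ : C → A)
    (hiso : ∀ X Y : C, (X ≅ Y) → Φ X = Φ Y) (hzero : ∀ X : C, IsZero X → Φ X = 0)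
    (hadd : ∀ X Y : C, Φ (X ⊞ Y) = Φ X + Φ Y) {ι : Type} [Fintype ι] (N : ι → C) :
    Φ (⨁ N) = ∑ i, Φ (N i) := by
  have key : ∀ (m : ℕ) (N : Fin m → C), Φ (⨁ N) = ∑ i, Φ (N i) := by
    intro m
    induction m with
    | zero =>
      intro N
      rw [Finset.univ_eq_empty, Finset.sum_empty]
      apply hzero
      rw [IsZero.iff_id_eq_zero]
      exact biproduct.hom_ext _ _ fun j => j.elim0
    | succ m ih =>
      intro N
      obtain ⟨e⟩ := nonempty_biproduct_cons (N 0) (fun i : Fin m => N i.succ)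
      have hN : (Fin.cons (N 0) (fun i : Fin m => N i.succ) : Fin (m + 1) → C) = N :=
        Fin.cons_self_tail N
      rw [hN] at e
      rw [Fin.sum_univ_succ, ← hiso _ _ e, hadd, ih]
  let e := Fintype.equivFin ι
  rw [hiso _ _ (biproduct.whiskerEquiv (g := fun j => N (e.symm j)) e
    fun i => eqToIso (by simp)), key]
  exact Equiv.sum_comp e.symm (fun i => Φ (N i))

end Summands

/-! ### Local endomorphism rings and Hom modulo the radical. -/

section HomFinite

variable {C : Type u} [Category.{v} C] [Abelian C] (k : Type w) [Field k] [Linear k C]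

theorem eq_zero_or_eq_id_of_indecomposable {X : C} (hX : Indecomposable X) (e : X ⟶ X)
    (he : e ≫ e = e) : e = 0 ∨ e = 𝟙 X := by
  obtain ⟨Y, i, r, hir, hri⟩ := IsIdempotentComplete.idempotents_split X e he
  by_cases hY : IsZero Y
  · left
    rw [← hri, hY.eq_of_tgt r 0, zero_comp]
  · right
    have := isIso_of_retract_of_indecomposable hX hY i r hir
    have h : r ≫ i ≫ r = r := by rw [hir, Category.comp_id]
    rw [← hri, ← cancel_mono r, Category.assoc, h, Category.id_comp]

/-- The morphisms `X ⟶ N` in the radical, for `N` with local endomorphism ring. -/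
def radHom (X N : C) [IsLocalRing (End N)] : Submodule k (X ⟶ N) where
  carrier := {f | ∀ g : N ⟶ X, (show End N from g ≫ f) ∈ nonunits (End N)}
  zero_mem' := fun g => by
    rw [comp_zero]
    exact zero_mem_nonunits.2 zero_ne_one
  add_mem' := fun {f f'} hf hf' g => by
    rw [Preadditive.comp_add]
    exact IsLocalRing.nonunits_add (hf g) (hf' g)
  smul_mem' := fun c f hf g => by
    have := hf (c • g)
    rwa [Linear.smul_comp, ← Linear.comp_smul] at this

theorem mem_radHom {X N : C} [IsLocalRing (End N)] (f : X ⟶ N) :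
    f ∈ radHom k X N ↔ ∀ g : N ⟶ X, ¬ IsIso (g ≫ f) := by
  simp only [← isUnit_iff_isIso]
  rfl

/-- A product of submodules as a product of modules. -/
def submoduleProdEquiv {R V W : Type*} [Ring R] [AddCommGroup V] [AddCommGroup W] [Module R V]
    [Module R W] (p : Submodule R V) (q : Submodule R W) : p.prod q ≃ₗ[R] p × q where
  toFun x := (⟨x.1.1, x.2.1⟩, ⟨x.1.2, x.2.2⟩)
  invFun x := ⟨(x.1.1, x.2.1), x.1.2, x.2.2⟩
  map_add' _ _ := rfl
  map_smul' _ _ := rfl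

/-- The dimension of the space of morphisms from `X` to `N` modulo the radical. -/
def topDim (X N : C) [IsLocalRing (End N)] : ℤ :=
  (Module.finrank k (X ⟶ N) : ℤ) - Module.finrank k (radHom k X N)

/-- Precomposition with an isomorphism, as a linear equivalence. -/
def homLinearEquivOfIso {X Y : C} (e : X ≅ Y) (N : C) : (X ⟶ N) ≃ₗ[k] (Y ⟶ N) where
  toFun f := e.inv ≫ f
  invFun f := e.hom ≫ f
  map_add' := by simp
  map_smul' := by simp
  left_inv := fun f => by simp
  right_inv := fun f => by simp

theorem topDim_congr {X Y : C} (e : X ≅ Y) (N : C) [IsLocalRing (End N)] :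
    topDim k X N = topDim k Y N := by
  have h : (radHom k X N).map (homLinearEquivOfIso k e N).toLinearMap = radHom k Y N := by
    ext f
    rw [Submodule.mem_map]
    constructor
    · rintro ⟨f, hf, rfl⟩
      rw [mem_radHom] at hf ⊢
      intro g
      have := hf (g ≫ e.inv)
      rwa [Category.assoc] at this
    · intro hf
      refine ⟨e.hom ≫ f, ?_, (homLinearEquivOfIso k e N).right_inv f⟩
      rw [mem_radHom] at hf ⊢
      intro g
      have := hf (g ≫ e.hom)
      rwa [Category.assoc] at this
  unfold topDim
  rw [← h, LinearEquiv.finrank_map_eq, (homLinearEquivOfIso k e N).finrank_eq]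

/-- Morphisms out of a direct sum are pairs of morphisms. -/
def biprodHomLinearEquiv (X Y N : C) : (X ⊞ Y ⟶ N) ≃ₗ[k] (X ⟶ N) × (Y ⟶ N) where
  toFun f := (biprod.inl ≫ f, biprod.inr ≫ f)
  invFun f := biprod.desc f.1 f.2
  map_add' := by simp
  map_smul' := by simp
  left_inv := fun f => by apply biprod.hom_ext' <;> simp
  right_inv := fun f => by simp

theorem topDim_of_isZero {X : C} (hX : IsZero X) (N : C) [IsLocalRing (End N)] :
    topDim k X N = 0 := by
  have : Subsingleton (X ⟶ N) := ⟨fun f g => hX.eq_of_src f g⟩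
  unfold topDim
  rw [Module.finrank_zero_of_subsingleton, Module.finrank_zero_of_subsingleton]
  simp

/-- If some `g ≫ f` were invertible, `N` would be a nonzero retract of the indecomposable `X` via
`f`, making `f` an isomorphism. So every morphism is radical. -/
theorem topDim_eq_zero {X N : C} (hX : Indecomposable X) (hN : ¬ IsZero N) [IsLocalRing (End N)]
    (h : ¬ Nonempty (X ≅ N)) : topDim k X N = 0 := by
  have : radHom k X N = ⊤ := by
    rw [eq_top_iff]
    intro f _
    rw [mem_radHom]
    intro g hg
    have := isIso_of_retract_of_indecomposable hX hN (inv (g ≫ f) ≫ g) f (by simp)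
    exact h ⟨asIso f⟩
  unfold topDim
  rw [this, finrank_top, sub_self]

variable [∀ X Y : C, FiniteDimensional k (X ⟶ Y)]

theorem finiteDimensional_end (X : C) : FiniteDimensional k (End X) :=
  inferInstanceAs (FiniteDimensional k (X ⟶ X))

/-- The Fitting idempotent of `a` is `0` or `1`: in the first case `a` is nilpotent and `1 - a` is a
unit, in the second `a` is a unit. -/
theorem isLocalRing_end (k : Type w) [Field k] [Linear k C]
    [∀ X Y : C, FiniteDimensional k (X ⟶ Y)] {X : C} (hX : Indecomposable X) : IsLocalRing (End X) := by
  have : Nontrivial (End X) := ⟨0, 1, fun h => hX.1 ((IsZero.iff_id_eq_zero X).2 h.symm)⟩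
  refine IsLocalRing.of_isUnit_or_isUnit_one_sub_self fun a => ?_
  have := finiteDimensional_end k X
  obtain ⟨e, b, he, hab, hba, n, hn⟩ := exists_fitting_idempotent k a
  rcases eq_zero_or_eq_id_of_indecomposable hX e he with h | h
  · right
    have : IsNilpotent a := ⟨n, by
      have h' : (1 - e : End X) = 1 := by rw [h]; exact sub_zero _
      rw [h', mul_one] at hn; exact hn⟩
    exact this.isUnit_one_sub
  · left
    rw [isUnit_iff_isIso]
    exact ⟨b, hba.symm.trans h, hab.symm.trans h⟩

/-- Nonunits of a local ring are closed under addition, so a morphism out of a direct sum is radical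
exactly when both components are. -/
theorem topDim_biprod (X Y N : C) [IsLocalRing (End N)] :
    topDim k (X ⊞ Y) N = topDim k X N + topDim k Y N := by
  have h : (radHom k (X ⊞ Y) N).map (biprodHomLinearEquiv k X Y N).toLinearMap =
      (radHom k X N).prod (radHom k Y N) := by
    ext ⟨f₁, f₂⟩
    rw [Submodule.mem_map, Submodule.mem_prod]
    constructor
    · rintro ⟨f, hf, hff⟩
      have h1 : biprod.inl ≫ f = f₁ := congrArg Prod.fst hff
      have h2 : biprod.inr ≫ f = f₂ := congrArg Prod.snd hff
      subst h1 h2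
      simp only [mem_radHom] at hf ⊢
      constructor
      · intro g
        have := hf (g ≫ biprod.inl)
        rwa [Category.assoc] at this
      · intro g
        have := hf (g ≫ biprod.inr)
        rwa [Category.assoc] at this
    · rintro ⟨h1, h2⟩
      refine ⟨biprod.desc f₁ f₂, ?_, (biprodHomLinearEquiv k X Y N).right_inv (f₁, f₂)⟩
      intro g
      have : g ≫ biprod.desc f₁ f₂ = (g ≫ biprod.fst) ≫ f₁ + (g ≫ biprod.snd) ≫ f₂ := by
        rw [biprod.desc_eq]; simp
      rw [this]
      exact IsLocalRing.nonunits_add (h1 _) (h2 _)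
  have h' : Module.finrank k (radHom k (X ⊞ Y) N) =
      Module.finrank k (radHom k X N) + Module.finrank k (radHom k Y N) := by
    rw [← LinearEquiv.finrank_map_eq (biprodHomLinearEquiv k X Y N), h,
      (submoduleProdEquiv (radHom k X N) (radHom k Y N)).finrank_eq, Module.finrank_prod]
  unfold topDim
  rw [h', (biprodHomLinearEquiv k X Y N).finrank_eq, Module.finrank_prod]
  push_cast
  ring

theorem topDim_self_pos (N : C) [IsLocalRing (End N)] : 0 < topDim k N N := by
  have h : radHom k N N < ⊤ := by
    rw [lt_top_iff_ne_top]
    intro h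
    have : (𝟙 N) ∈ radHom k N N := h ▸ Submodule.mem_top
    rw [mem_radHom] at this
    exact this (𝟙 N) (by rw [Category.comp_id]; infer_instance)
  have := Submodule.finrank_lt h.ne
  unfold topDim
  omega

end HomFinite

/-! ### Isomorphism classes and the Krull–Schmidt property. -/

section IsoClasses

variable (C : Type u) [Category.{v} C]

/-- Isomorphism classes of objects. -/
abbrev IsoClass : Type u := Quotient (isIsomorphicSetoid C)

variable {C}

/-- The isomorphism class of an object. -/
def isoClass (X : C) : IsoClass C := Quotient.mk (isIsomorphicSetoid C) X

theorem isoClass_eq_iff {X Y : C} : isoClass X = isoClass Y ↔ Nonempty (X ≅ Y) :=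
  Quotient.eq (r := isIsomorphicSetoid C)

theorem isoClass_eq {X Y : C} (e : X ≅ Y) : isoClass X = isoClass Y :=
  isoClass_eq_iff.2 ⟨e⟩

theorem IsoClass.exists_rep (q : IsoClass C) : ∃ X : C, isoClass X = q := Quotient.exists_rep q

variable (C) in
/-- A category in which every object is, in an essentially unique way, a finite direct sum of
indecomposable objects. -/
class KrullSchmidt [Abelian C] : Prop where
  exists_decomposition : ∀ X : C, ∃ m, HasIndecDecomposition X m
  unique : ∀ {m n : ℕ} (N : Fin m → C) (N' : Fin n → C), (∀ i, Indecomposable (N i)) →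
    (∀ i, Indecomposable (N' i)) → ((⨁ N) ≅ ⨁ N') →
    Finset.univ.val.map (fun i => isoClass (N i)) = Finset.univ.val.map fun i => isoClass (N' i)
  -- Kept as an axiom so that injective hulls can be recognised later without reference to a ground
  -- field.
  fitting : ∀ {X : C} (a : End X), ∃ e b : End X, e * e = e ∧ e = a * b ∧ e = b * a ∧
    ∃ n : ℕ, a ^ n * (1 - e) = 0

end IsoClasses

/-! ### Krull–Schmidt and projective covers in Hom-finite categories. -/

section HomFinite

variable {C : Type u} [Category.{v} C] [Abelian C] (k : Type w) [Field k] [Linear k C]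
  [∀ X Y : C, FiniteDimensional k (X ⟶ Y)]

open scoped Classical in
theorem topDim_biproduct {m : ℕ} (N : Fin m → C) (hN : ∀ i, Indecomposable (N i))
    (X : C) (hX : Indecomposable X) [IsLocalRing (End X)] :
    topDim k (⨁ N) X =
      (Finset.univ.val.map fun i => isoClass (N i)).count (isoClass X) * topDim k X X := by
  rw [map_biproduct_eq_sum (fun Y => topDim k Y X) (fun Y Z e => topDim_congr k e X)
    (fun Y hY => topDim_of_isZero k hY X) (fun Y Z => topDim_biprod k Y Z X) N]
  have h : ∀ i, topDim k (N i) X =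
      if isoClass X = isoClass (N i) then topDim k X X else 0 := by
    intro i
    split_ifs with h
    · obtain ⟨e⟩ := isoClass_eq_iff.1 h
      exact topDim_congr k e.symm X
    · exact topDim_eq_zero k (hN i) hX.1 fun ⟨e⟩ => h (isoClass_eq e.symm)
  rw [Finset.sum_congr rfl fun i _ => h i, Finset.sum_ite, Finset.sum_const_zero, add_zero,
    Finset.sum_const, nsmul_eq_mul, Multiset.count_map]
  rfl

/-- The multiplicity of an indecomposable `X` in any decomposition is the invariant `topDim k _ X`
divided by the positive number `topDim k X X`. -/
theorem krullSchmidt_of_homFinite (k : Type w) [Field k] [Linear k C]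
    [∀ X Y : C, FiniteDimensional k (X ⟶ Y)] : KrullSchmidt C where
  exists_decomposition X := exists_indecDecomposition_aux k _ X (Nat.lt_succ_self _)
  unique {m n} N N' hN hN' e := by
    classical
    ext q
    obtain ⟨X, rfl⟩ := q.exists_rep
    by_cases hX : Indecomposable X
    · have := isLocalRing_end k hX
      have h := topDim_congr k e X
      rw [topDim_biproduct k N hN X hX, topDim_biproduct k N' hN' X hX] at h
      have := mul_right_cancel₀ (topDim_self_pos k X).ne' h
      exact_mod_cast this
    · have : ∀ {l : ℕ} (L : Fin l → C), (∀ i, Indecomposable (L i)) →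
          (Finset.univ.val.map fun i => isoClass (L i)).count (isoClass X) = 0 := by
        intro l L hL
        rw [Multiset.count_eq_zero, Multiset.mem_map]
        rintro ⟨i, -, hi⟩
        obtain ⟨e⟩ := isoClass_eq_iff.1 hi
        exact hX (indecomposable_of_iso e (hL i))
      rw [this N hN, this N' hN']
  fitting {X} a := by
    have := finiteDimensional_end k X
    exact exists_fitting_idempotent k a

/-- A non-epimorphism `g` with `g ≫ f` epi yields an endomorphism `a` of `P` over `X` that factors
through `g`. Its Fitting summand still maps onto `X`. That summand is proper, since otherwise `g`
would be a split epimorphism, so the dimension of `End P` drops. -/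
theorem exists_isProjectiveCover_aux (k : Type w) [Field k] [Linear k C]
    [∀ X Y : C, FiniteDimensional k (X ⟶ Y)] (n : ℕ) :
    ∀ (P X : C) (f : P ⟶ X), Projective P → Epi f → Module.finrank k (P ⟶ P) < n →
      ∃ (P' : C) (f' : P' ⟶ X), IsProjectiveCover f' := by
  induction n with
  | zero => intro P X f _ _ h; omega
  | succ n ih =>
    intro P X f hP hf hn
    by_cases hess : ∀ (Z : C) (g : Z ⟶ P), Epi (g ≫ f) → Epi g
    · exact ⟨P, f, hP, hf, hess⟩
    push Not at hess
    obtain ⟨Z, g, hgf, hg⟩ := hess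
    let a : End P := Projective.factorThru f (g ≫ f) ≫ g
    have ha : ∀ m : ℕ, (show P ⟶ P from a ^ m) ≫ f = f := by
      intro m
      induction m with
      | zero => exact Category.id_comp f
      | succ m ihm =>
        change (a ≫ (show P ⟶ P from a ^ m)) ≫ f = f
        rw [Category.assoc, ihm]
        change (_ ≫ g) ≫ f = f
        rw [Category.assoc, Projective.factorThru_comp]
    have := finiteDimensional_end k P
    obtain ⟨e, b, he, hab, hba, m, hm⟩ := exists_fitting_idempotent k a
    have hef : (show P ⟶ P from e) ≫ f = f := by
      rw [mul_sub, mul_one, sub_eq_zero] at hm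
      -- Multiplication in `End` is composition in the opposite order.
      have h3 : (show P ⟶ P from e) ≫ (show P ⟶ P from a ^ m) = (show P ⟶ P from a ^ m) :=
        hm.symm
      calc (show P ⟶ P from e) ≫ f
          = (show P ⟶ P from e) ≫ (show P ⟶ P from a ^ m) ≫ f := by rw [ha m]
        _ = f := by rw [← Category.assoc, h3, ha m]
    obtain ⟨P₁, i, r, hir, hri⟩ := IsIdempotentComplete.idempotents_split P _ he
    have hP₁ : Projective P₁ := Retract.projective ⟨i, r, hir⟩
    have hepi : Epi (i ≫ f) := by
      have : r ≫ i ≫ f = f := by rw [← Category.assoc, hri, hef]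
      rw [← this] at hf
      exact epi_of_epi r (i ≫ f)
    obtain ⟨P₂, e', he', he''⟩ := exists_biprod_of_retract i r hir
    by_cases hP₂ : IsZero P₂
    · exfalso
      apply hg
      have h1 : r ≫ i = 𝟙 P := by
        rw [← he', ← he'', ← cancel_mono e'.hom]
        apply (cancel_epi e'.inv).1
        apply biprod.hom_ext
        · simp
        · exact hP₂.eq_of_tgt _ _
      have h2 : ((show P ⟶ P from b) ≫ Projective.factorThru f (g ≫ f)) ≫ g = 𝟙 P := by
        rw [← h1, hri, Category.assoc]
        exact hab.symm
      have : IsSplitEpi g := ⟨⟨_, h2⟩⟩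
      infer_instance
    · have h1 := finrank_end_add_le k e'
      have h2 := finrank_end_pos k hP₂
      exact ih P₁ X (i ≫ f) hP₁ hepi (by omega)

theorem exists_isProjectiveCover (k : Type w) [Field k] [Linear k C]
    [∀ X Y : C, FiniteDimensional k (X ⟶ Y)] [EnoughProjectives C] (X : C) :
    ∃ (P : C) (f : P ⟶ X), IsProjectiveCover f :=
  exists_isProjectiveCover_aux k _ (Projective.over X) X (Projective.π X) inferInstance
    inferInstance (Nat.lt_succ_self _)

end HomFinite

/-! ### Multisets of indecomposable and of non-projective summands. -/

section Classes

variable {C : Type u} [Category.{v} C] [Abelian C]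

variable (C) in
/-- Isomorphism classes of non-projective indecomposable objects. -/
abbrev NPClass : Type u := {q : IsoClass C // ∃ X : C, isoClass X = q ∧ IsNonprojIndec X}

theorem NPClass.isNonprojIndec (q : NPClass C) {X : C} (h : isoClass X = q.1) :
    IsNonprojIndec X := by
  obtain ⟨Y, hY, hY'⟩ := q.2
  obtain ⟨e⟩ := isoClass_eq_iff.1 (hY.trans h.symm)
  exact isNonprojIndec_of_iso e hY'

/-- The class of a non-projective indecomposable object. -/
def npClass (X : C) (h : IsNonprojIndec X) : NPClass C := ⟨isoClass X, X, rfl, h⟩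

theorem NPClass.exists_rep (q : NPClass C) : ∃ (X : C) (h : IsNonprojIndec X), npClass X h = q := by
  obtain ⟨_, X, rfl, h⟩ := q
  exact ⟨X, h, rfl⟩

variable [KrullSchmidt C]

/-- The multiset of isomorphism classes of the indecomposable summands of an object. -/
def indecClasses (X : C) : Multiset (IsoClass C) :=
  Finset.univ.val.map fun i =>
    isoClass ((KrullSchmidt.exists_decomposition X).choose_spec.choose i)

theorem indecClasses_eq {X : C} {m : ℕ} {N : Fin m → C} (hN : ∀ i, Indecomposable (N i))
    (e : X ≅ ⨁ N) : indecClasses X = Finset.univ.val.map fun i => isoClass (N i) := by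
  obtain ⟨h, ⟨e'⟩⟩ := (KrullSchmidt.exists_decomposition X).choose_spec.choose_spec
  exact KrullSchmidt.unique _ _ h hN (e'.symm ≪≫ e)

theorem indecClasses_congr {X Y : C} (e : X ≅ Y) : indecClasses X = indecClasses Y := by
  obtain ⟨m, N, hN, ⟨e'⟩⟩ := KrullSchmidt.exists_decomposition Y
  rw [indecClasses_eq hN e', indecClasses_eq hN (e ≪≫ e')]

theorem indecClasses_of_isZero {X : C} (h : IsZero X) : indecClasses X = 0 := by
  have h0 : IsZero (⨁ (fun i : Fin 0 => i.elim0 : Fin 0 → C)) := by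
    rw [IsZero.iff_id_eq_zero]
    exact biproduct.hom_ext _ _ fun j => j.elim0
  rw [indecClasses_eq (fun i => i.elim0) (h.iso h0)]
  rfl

theorem indecClasses_cons {A : C} (hA : Indecomposable A) (Z : C) :
    indecClasses (A ⊞ Z) = isoClass A ::ₘ indecClasses Z := by
  obtain ⟨m, N, hN, ⟨e⟩⟩ := KrullSchmidt.exists_decomposition Z
  obtain ⟨c⟩ := nonempty_biproduct_cons A N
  rw [indecClasses_eq hN e, indecClasses_eq (N := Fin.cons A N) ?_
    (biprod.mapIso (Iso.refl A) e ≪≫ c)]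
  · rw [Fin.univ_val_map, Fin.univ_val_map, List.ofFn_succ]
    rfl
  · intro i
    induction i using Fin.cases with
    | zero => exact hA
    | succ i => exact hN i

/-- Induction over the indecomposable summands of an object. -/
theorem indec_induction {P : C → Prop} (hiso : ∀ X Y : C, (X ≅ Y) → P X → P Y)
    (hzero : ∀ X : C, IsZero X → P X)
    (hcons : ∀ A Z : C, Indecomposable A → P Z → P (A ⊞ Z)) (X : C) : P X := by
  obtain ⟨m, N, hN, ⟨e⟩⟩ := KrullSchmidt.exists_decomposition X
  refine hiso _ _ e.symm ?_
  clear e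
  induction m with
  | zero =>
    apply hzero
    rw [IsZero.iff_id_eq_zero]
    exact biproduct.hom_ext _ _ fun j => j.elim0
  | succ m ih =>
    obtain ⟨c⟩ := nonempty_biproduct_cons (N 0) (fun i : Fin m => N i.succ)
    have hc : (Fin.cons (N 0) (fun i : Fin m => N i.succ) : Fin (m + 1) → C) = N :=
      Fin.cons_self_tail N
    rw [hc] at c
    exact hiso _ _ c (hcons _ _ (hN 0) (ih _ fun i => hN i.succ))

/-- A function that vanishes on zero objects and is additive in indecomposable summands is
additive. -/
theorem map_biprod_of_cons {A : Type*} [AddCommMonoid A] (Φ : C → A)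
    (hiso : ∀ X Y : C, (X ≅ Y) → Φ X = Φ Y) (hzero : ∀ X : C, IsZero X → Φ X = 0)
    (hcons : ∀ B Z : C, Indecomposable B → Φ (B ⊞ Z) = Φ B + Φ Z) (X Y : C) :
    Φ (X ⊞ Y) = Φ X + Φ Y := by
  induction X using indec_induction with
  | hiso X X' e h =>
    rw [← hiso _ _ e, ← h]
    exact hiso _ _ (biprod.mapIso e.symm (Iso.refl Y))
  | hzero X h =>
    rw [hzero X h, zero_add]
    exact hiso _ _ (biprod.braiding X Y ≪≫ (isoBiprodZero h).symm)
  | hcons A Z hA h =>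
    rw [hiso _ _ (biprod.associator A Z Y), hcons _ _ hA, h, hcons _ _ hA, add_assoc]

theorem indecClasses_of_indecomposable {A : C} (hA : Indecomposable A) :
    indecClasses A = {isoClass A} := by
  rw [indecClasses_congr (isoBiprodZero (isZero_zero C) : A ≅ A ⊞ 0), indecClasses_cons hA,
    indecClasses_of_isZero (isZero_zero C)]
  rfl

theorem indecClasses_biprod (X Y : C) :
    indecClasses (X ⊞ Y) = indecClasses X + indecClasses Y :=
  map_biprod_of_cons indecClasses (fun _ _ => indecClasses_congr)
    (fun _ => indecClasses_of_isZero)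
    (fun B Z hB => by
      rw [indecClasses_cons hB, indecClasses_of_indecomposable hB, Multiset.singleton_add]) X Y

theorem indecomposable_of_mem {X : C} : ∀ {A : C}, isoClass A ∈ indecClasses X →
    Indecomposable A ∧ IsSummand A X := by
  induction X using indec_induction with
  | hiso X Y e h =>
    intro A hA
    obtain ⟨h1, Z, ⟨e'⟩⟩ := h ((indecClasses_congr e).symm ▸ hA)
    exact ⟨h1, Z, ⟨e.symm ≪≫ e'⟩⟩
  | hzero X h =>
    intro A hA
    rw [indecClasses_of_isZero h] at hA
    exact absurd hA (Multiset.notMem_zero _)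
  | hcons B Z hB h =>
    intro A hA
    rw [indecClasses_cons hB, Multiset.mem_cons] at hA
    rcases hA with hA | hA
    · obtain ⟨e⟩ := isoClass_eq_iff.1 hA
      exact ⟨indecomposable_of_iso e.symm hB, Z, ⟨biprod.mapIso e.symm (Iso.refl Z)⟩⟩
    · obtain ⟨h1, W, ⟨e⟩⟩ := h hA
      refine ⟨h1, B ⊞ W, ⟨?_⟩⟩
      exact biprod.mapIso (Iso.refl B) e ≪≫ (biprod.associator B A W).symm ≪≫
        biprod.mapIso (biprod.braiding B A) (Iso.refl W) ≪≫ biprod.associator A B W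

theorem isZero_of_indecClasses_eq_zero {X : C} : indecClasses X = 0 → IsZero X := by
  induction X using indec_induction with
  | hiso X Y e h => exact fun h' => (h ((indecClasses_congr e).trans h')).of_iso e.symm
  | hzero X h => exact fun _ => h
  | hcons A Z hA h =>
    intro h'
    rw [indecClasses_cons hA] at h'
    exact absurd h' (Multiset.cons_ne_zero)

/-- An indecomposable summand peeled off `X` must also split off `Y`, and its class cancels from
both multisets. -/
theorem nonempty_iso_of_indecClasses_eq {X Y : C} :
    indecClasses X = indecClasses Y → Nonempty (X ≅ Y) := by
  induction X using indec_induction generalizing Y with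
  | hiso X X' e h =>
    intro h'
    obtain ⟨e'⟩ := h ((indecClasses_congr e).trans h')
    exact ⟨e.symm ≪≫ e'⟩
  | hzero X h =>
    intro h'
    rw [indecClasses_of_isZero h] at h'
    exact ⟨h.iso (isZero_of_indecClasses_eq_zero h'.symm)⟩
  | hcons A Z hA h =>
    intro h'
    rw [indecClasses_cons hA] at h'
    obtain ⟨-, W, ⟨e⟩⟩ := indecomposable_of_mem (h' ▸ Multiset.mem_cons_self _ _)
    rw [indecClasses_congr e, indecClasses_cons hA, Multiset.cons_inj_right] at h'
    obtain ⟨e'⟩ := h h'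
    exact ⟨biprod.mapIso (Iso.refl A) e' ≪≫ e.symm⟩

theorem indecomposable_of_indecClasses_eq_singleton {X : C} {q : IsoClass C}
    (h : indecClasses X = {q}) : Indecomposable X ∧ isoClass X = q := by
  obtain ⟨A, rfl⟩ := q.exists_rep
  have hA := (indecomposable_of_mem (h ▸ Multiset.mem_singleton_self _)).1
  obtain ⟨e⟩ := nonempty_iso_of_indecClasses_eq (h.trans (indecClasses_of_indecomposable hA).symm)
  exact ⟨indecomposable_of_iso e.symm hA, isoClass_eq e⟩

open scoped Classical in
/-- The multiset of classes of the non-projective indecomposable summands of an object. -/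
def npSummands (X : C) : Multiset (NPClass C) :=
  (indecClasses X).filterMap fun q =>
    if h : ∃ X : C, isoClass X = q ∧ IsNonprojIndec X then some ⟨q, h⟩ else none

theorem npSummands_congr {X Y : C} (e : X ≅ Y) : npSummands X = npSummands Y := by
  rw [npSummands, indecClasses_congr e, npSummands]

theorem npSummands_biprod (X Y : C) : npSummands (X ⊞ Y) = npSummands X + npSummands Y := by
  rw [npSummands, indecClasses_biprod, Multiset.filterMap_add]
  rfl

theorem npSummands_of_isZero {X : C} (h : IsZero X) : npSummands X = 0 := by
  rw [npSummands, indecClasses_of_isZero h]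
  rfl

theorem npSummands_of_isNonprojIndec {X : C} (h : IsNonprojIndec X) :
    npSummands X = {npClass X h} := by
  rw [npSummands, indecClasses_of_indecomposable h.1, ← Multiset.cons_zero,
    Multiset.filterMap_cons_some _ _ _ (b := npClass X h), Multiset.filterMap_zero]
  · rfl
  · exact dif_pos ⟨X, rfl, h⟩

theorem mem_npSummands {X : C} (q : NPClass C) : q ∈ npSummands X ↔ q.1 ∈ indecClasses X := by
  rw [npSummands, Multiset.mem_filterMap]
  constructor
  · rintro ⟨a, ha, h⟩
    split_ifs at h with h'
    rw [← Option.some.inj h]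
    exact ha
  · intro h
    exact ⟨q.1, h, dif_pos q.2⟩

theorem npSummands_of_projective {X : C} (h : Projective X) : npSummands X = 0 := by
  rw [Multiset.eq_zero_iff_forall_notMem]
  intro q hq
  rw [mem_npSummands] at hq
  obtain ⟨A, hA, rfl⟩ := q.exists_rep
  exact hA.2 (projective_of_isSummand h (indecomposable_of_mem hq).2)

theorem projective_of_npSummands_eq_zero {X : C} : npSummands X = 0 → Projective X := by
  induction X using indec_induction with
  | hiso X Y e h => exact fun h' => Projective.of_iso e (h ((npSummands_congr e).trans h'))
  | hzero X h => exact fun _ => Projective.of_iso (h.iso (isZero_zero C)).symm inferInstance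
  | hcons A Z hA h =>
    intro h'
    rw [npSummands_biprod, add_eq_zero] at h'
    have h1 := h h'.2
    have h2 : Projective A := by
      by_contra h3
      rw [npSummands_of_isNonprojIndec ⟨hA, h3⟩] at h'
      exact Multiset.singleton_ne_zero _ h'.1
    infer_instance

theorem exists_isSummand_of_mem_npSummands {X : C} {q : NPClass C} (h : q ∈ npSummands X) :
    ∃ (A : C) (hA : IsNonprojIndec A), npClass A hA = q ∧ IsSummand A X := by
  obtain ⟨A, hA, rfl⟩ := q.exists_rep
  rw [mem_npSummands] at h
  exact ⟨A, hA, rfl, (indecomposable_of_mem h).2⟩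

theorem filterMap_congr_of_mem {α β : Type*} {f g : α → Option β} {s : Multiset α}
    (h : ∀ a ∈ s, f a = g a) : s.filterMap f = s.filterMap g := by
  induction s using Multiset.induction_on with
  | empty => rfl
  | cons a s ih =>
    rw [Multiset.filterMap_cons, Multiset.filterMap_cons, h a (Multiset.mem_cons_self a s),
      ih fun b hb => h b (Multiset.mem_cons_of_mem hb)]

/-- An object has no nonzero projective summand. -/
def ProjFree (X : C) : Prop := ∀ Q : C, Projective Q → IsSummand Q X → IsZero Q

/-- Nothing is filtered out: a projective indecomposable summand would have to be zero. -/
theorem map_npSummands {X : C} (h : ProjFree X) :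
    (npSummands X).map Subtype.val = indecClasses X := by
  rw [npSummands, Multiset.map_filterMap]
  conv_rhs => rw [← Multiset.filterMap_some (indecClasses X)]
  refine filterMap_congr_of_mem fun q hq => ?_
  obtain ⟨A, rfl⟩ := q.exists_rep
  obtain ⟨h1, h2⟩ := indecomposable_of_mem hq
  have hA : ∃ Y : C, isoClass Y = isoClass A ∧ IsNonprojIndec Y :=
    ⟨A, rfl, h1, fun h3 => h1.1 (h A h3 h2)⟩
  rw [dif_pos hA]
  rfl

theorem isNonprojIndec_of_npSummands_eq_singleton {X : C} (h : ProjFree X) {q : NPClass C}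
    (hq : npSummands X = {q}) : isoClass X = q.1 := by
  have := map_npSummands h
  rw [hq, Multiset.map_singleton] at this
  exact (indecomposable_of_indecClasses_eq_singleton this.symm).2

theorem npSummands_of_isCore {K X : C} (h : IsCore K X) : npSummands K = npSummands X := by
  obtain ⟨⟨P, hP, ⟨e⟩⟩, -⟩ := h
  rw [npSummands_congr e, npSummands_biprod, npSummands_of_projective hP, add_zero]

theorem card_of_hasIndecDecomposition {X : C} {m : ℕ} (h : HasIndecDecomposition X m) :
    m = Multiset.card (indecClasses X) := by
  obtain ⟨N, hN, ⟨e⟩⟩ := h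
  rw [indecClasses_eq hN e]
  simp

/-- Frees the count from the arbitrary choices of a core and of a decomposition. -/
theorem card_of_isCore {K X : C} {m : ℕ} (h : IsCore K X) (hm : HasIndecDecomposition K m) :
    m = Multiset.card (npSummands X) := by
  rw [card_of_hasIndecDecomposition hm, ← map_npSummands h.2, Multiset.card_map,
    npSummands_of_isCore h]

end Classes

/-! ### Syzygies up to projective summands, and the splittings behind Schanuel's lemma. -/

section Schanuel

variable {C : Type u} [Category.{v} C] [Abelian C]

/-- `Y` is the kernel of some epimorphism from a projective object to `X`. -/
def StabSyz (Y X : C) : Prop :=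
  ∃ (P : C) (i : Y ⟶ P) (f : P ⟶ X) (w : i ≫ f = 0), Projective P ∧
    (ShortComplex.mk i f w).ShortExact

theorem StabSyz.congr {Y X Y' X' : C} (h : StabSyz Y X) (e : Y ≅ Y') (e' : X ≅ X') :
    StabSyz Y' X' := by
  obtain ⟨P, i, f, w, hP, hS⟩ := h
  refine ⟨P, e.inv ≫ i, f ≫ e'.hom, by simp [reassoc_of% w], hP, ?_⟩
  exact ShortComplex.shortExact_of_iso (ShortComplex.isoMk e (Iso.refl P) e' (by simp) (by simp)) hS

theorem StabSyz.of_projective {P : C} (hP : Projective P) {Z : C} (hZ : IsZero Z) :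
    StabSyz P Z := by
  refine ⟨P, 𝟙 P, 0, by simp, hP, ?_⟩
  have : Epi (0 : P ⟶ Z) := ⟨fun g h _ => hZ.eq_of_src g h⟩
  refine ShortComplex.ShortExact.mk' ?_ (by dsimp; infer_instance) this
  exact ShortComplex.exact_of_f_is_kernel _ (KernelFork.IsLimit.ofId _ rfl)

theorem StabSyz.of_projective_right {P : C} (hP : Projective P) {Z : C} (hZ : IsZero Z) :
    StabSyz Z P := by
  refine ⟨P, 0, 𝟙 P, by simp, hP, ?_⟩
  have : Mono (0 : Z ⟶ P) := ⟨fun g h _ => hZ.eq_of_tgt g h⟩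
  refine ShortComplex.ShortExact.mk' ?_ this (by dsimp; infer_instance)
  exact ShortComplex.exact_of_g_is_cokernel _ (CokernelCofork.IsColimit.ofId _ rfl)

theorem shortExact_kernel {P X : C} (f : P ⟶ X) [Epi f] :
    (ShortComplex.mk (kernel.ι f) f (kernel.condition f)).ShortExact :=
  ShortComplex.ShortExact.mk' (ShortComplex.exact_of_f_is_kernel _ (kernelIsKernel f))
    (by dsimp; infer_instance) (by dsimp; infer_instance)

theorem shortExact_cokernel {Y P : C} (i : Y ⟶ P) [Mono i] :
    (ShortComplex.mk i (cokernel.π i) (cokernel.condition i)).ShortExact :=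
  ShortComplex.ShortExact.mk' (ShortComplex.exact_of_g_is_cokernel _ (cokernelIsCokernel i))
    (by dsimp; infer_instance) (by dsimp; infer_instance)

theorem StabSyz.biprod {Y X Y' X' : C} (h : StabSyz Y X) (h' : StabSyz Y' X') :
    StabSyz (Y ⊞ Y') (X ⊞ X') := by
  obtain ⟨P, i, f, w, hP, hS⟩ := h
  obtain ⟨P', i', f', w', hP', hS'⟩ := h'
  have := hS.mono_f
  have := hS'.mono_f
  have := hS.epi_g
  have := hS'.epi_g
  dsimp at *
  refine ⟨P ⊞ P', biprod.map i i', biprod.map f f', ?_, inferInstance, ?_⟩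
  · apply biprod.hom_ext <;> apply biprod.hom_ext' <;> simp [w, w']
  refine ShortComplex.ShortExact.mk' ?_ (by dsimp; infer_instance) (by dsimp; infer_instance)
  apply ShortComplex.exact_of_f_is_kernel
  refine KernelFork.IsLimit.ofι' (biprod.map i i') _ fun {A} k hk => ?_
  have h1 : (k ≫ biprod.fst) ≫ f = 0 := by
    have := congrArg (· ≫ biprod.fst) hk
    simpa using this
  have h2 : (k ≫ biprod.snd) ≫ f' = 0 := by
    have := congrArg (· ≫ biprod.snd) hk
    simpa using this
  refine ⟨biprod.lift (hS.exact.lift _ h1) (hS'.exact.lift _ h2), ?_⟩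
  have h3 := hS.exact.lift_f _ h1
  have h4 := hS'.exact.lift_f _ h2
  dsimp at h3 h4
  apply biprod.hom_ext <;> simp [h3, h4]

/-- The kernel consists of pairs `(x, y)` with `f x + f' y = 0`. The shear `(x, y) ↦ (x + b y, y)`
identifies it with `ker f ⊞ P'`. The cokernel version below is dual. -/
theorem nonempty_kernel_desc_iso {Y P X P' : C} {i : Y ⟶ P} {f : P ⟶ X} {w : i ≫ f = 0}
    (hS : (ShortComplex.mk i f w).ShortExact) (b : P' ⟶ P) (f' : P' ⟶ X) (hb : b ≫ f = f') :
    Nonempty (kernel (biprod.desc f f') ≅ Y ⊞ P') := by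
  have := hS.mono_f
  dsimp at this
  have h : ∀ {K : C} (κ : K ⟶ P ⊞ P'),
      (κ ≫ biprod.fst + κ ≫ biprod.snd ≫ b) ≫ f = κ ≫ biprod.desc f f' := by
    intro K κ
    rw [biprod.desc_eq]
    simp [hb]
  obtain ⟨l, hl⟩ := hS.exact.lift' _ ((h (kernel.ι _)).trans (kernel.condition _))
  dsimp at l hl
  let m := kernel.lift (biprod.desc f f') (biprod.desc (biprod.lift i 0) (biprod.lift (-b) (𝟙 P')))
    (by apply biprod.hom_ext' <;> simp [w, hb])
  have hm : m ≫ kernel.ι (biprod.desc f f') =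
    biprod.desc (biprod.lift i 0) (biprod.lift (-b) (𝟙 P')) := kernel.lift_ι _ _ _
  clear_value m
  refine ⟨⟨biprod.lift l (kernel.ι (biprod.desc f f') ≫ biprod.snd), m, ?_, ?_⟩⟩
  · rw [← cancel_mono (kernel.ι (biprod.desc f f')), Category.assoc, hm]
    apply biprod.hom_ext <;> simp [hl]
  · apply biprod.hom_ext
    · rw [← cancel_mono i]
      apply biprod.hom_ext' <;> simp [hl, reassoc_of% hm]
    · apply biprod.hom_ext' <;> simp [reassoc_of% hm]

theorem nonempty_cokernel_lift_iso {Y P X P' : C} {i : Y ⟶ P} {f : P ⟶ X} {w : i ≫ f = 0}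
    (hS : (ShortComplex.mk i f w).ShortExact) (b : P ⟶ P') (i' : Y ⟶ P') (hb : i ≫ b = i') :
    Nonempty (cokernel (biprod.lift i i') ≅ X ⊞ P') := by
  have := hS.epi_g
  dsimp at this
  have h : ∀ {K : C} (κ : P ⊞ P' ⟶ K),
      i ≫ (biprod.inl ≫ κ + b ≫ biprod.inr ≫ κ) = biprod.lift i i' ≫ κ := by
    intro K κ
    rw [biprod.lift_eq]
    simp [reassoc_of% hb]
  obtain ⟨l, hl⟩ := hS.exact.desc' _ ((h (cokernel.π _)).trans (cokernel.condition _))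
  dsimp at l hl
  let m := cokernel.desc (biprod.lift i i') (biprod.desc (biprod.lift f (-b))
    (biprod.lift 0 (𝟙 P'))) (by apply biprod.hom_ext <;> simp [w, hb])
  have hm : cokernel.π (biprod.lift i i') ≫ m =
    biprod.desc (biprod.lift f (-b)) (biprod.lift 0 (𝟙 P')) := cokernel.π_desc _ _ _
  clear_value m
  refine ⟨⟨m, biprod.desc l (biprod.inr ≫ cokernel.π (biprod.lift i i')), ?_, ?_⟩⟩
  · rw [← cancel_epi (cokernel.π (biprod.lift i i')), reassoc_of% hm]
    apply biprod.hom_ext' <;> simp [hl]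
  · apply biprod.hom_ext'
    · rw [← cancel_epi f]
      apply biprod.hom_ext <;> simp [reassoc_of% hl, hm]
    · apply biprod.hom_ext <;> simp [hm]

end Schanuel

/-! ### Frobenius categories and the permutation induced by `Ω`. -/

section Frobenius

variable {C : Type u} [Category.{v} C] [Abelian C]

variable (C) in
/-- A Frobenius abelian category with projective covers. -/
class Frobenius : Prop where
  projective_iff_injective : ∀ X : C, Projective X ↔ Injective X
  exists_isProjectiveCover : ∀ X : C, ∃ (P : C) (f : P ⟶ X), IsProjectiveCover f
  exists_mono_injective : ∀ X : C, ∃ (I : C) (i : X ⟶ I), Injective I ∧ Mono i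

theorem IsSyzygy.stabSyz {Y X : C} (h : IsSyzygy Y X) : StabSyz Y X := by
  obtain ⟨P, f, hf, ⟨e⟩⟩ := h
  have := hf.epi
  exact StabSyz.congr ⟨P, _, f, _, hf.projective, shortExact_kernel f⟩ e.symm (Iso.refl X)

/-- A projective summand `Q` of the kernel is injective, so it splits off `P`. Since `f` kills `Q`,
the complement still maps onto `X`; by essentiality it is all of `P`, and `Q = 0`. -/
theorem IsProjectiveCover.projFree_kernel [Frobenius C] {P X : C} {f : P ⟶ X}
    (h : IsProjectiveCover f) : ProjFree (kernel f) := by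
  intro Q hQ hs
  obtain ⟨i, r, hir⟩ := hs.exists_retract
  have hQ' : Injective Q := (Frobenius.projective_iff_injective Q).1 hQ
  have := h.epi
  have : Mono i := (⟨⟨r, hir⟩⟩ : IsSplitMono i).mono
  let j := i ≫ kernel.ι f
  obtain ⟨Z, e, -, he⟩ := exists_biprod_of_retract j (Injective.factorThru (𝟙 Q) j)
    (Injective.comp_factorThru _ _)
  have hjf : j ≫ f = 0 := by simp [j]
  have h1 : e.inv ≫ f = biprod.snd ≫ (biprod.inr ≫ e.inv ≫ f) := by
    apply biprod.hom_ext'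
    · rw [reassoc_of% he, hjf]; simp
    · simp
  have h2 : Epi ((biprod.inr ≫ e.inv) ≫ f) := by
    have : Epi (e.inv ≫ f) := inferInstance
    rw [h1] at this
    rw [Category.assoc]
    exact epi_of_epi (biprod.snd : Q ⊞ Z ⟶ Z) (biprod.inr ≫ e.inv ≫ f)
  have h3 : Epi (biprod.inr ≫ e.inv) := h.essential _ _ h2
  rw [IsZero.iff_id_eq_zero]
  have h4 : (biprod.inr ≫ e.inv) ≫ e.hom ≫ (biprod.fst : Q ⊞ Z ⟶ Q) =
      (biprod.inr ≫ e.inv) ≫ 0 := by simp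
  have h5 := (cancel_epi _).1 h4
  have h6 : (biprod.inl : Q ⟶ Q ⊞ Z) ≫ e.inv ≫ e.hom ≫ biprod.fst = 0 := by
    rw [h5]; simp
  simpa using h6

theorem IsInjectiveHull.projFree_cokernel [Frobenius C] {Y I : C} {f : Y ⟶ I}
    (h : IsInjectiveHull f) : ProjFree (cokernel f) := by
  intro Q hQ hs
  obtain ⟨i, r, hir⟩ := hs.exists_retract
  have := h.mono
  have : Epi r := (⟨⟨i, hir⟩⟩ : IsSplitEpi r).epi
  let j := cokernel.π f ≫ r
  obtain ⟨Z, e, he, -⟩ := exists_biprod_of_retract (Projective.factorThru (𝟙 Q) j) j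
    (Projective.factorThru_comp _ _)
  have hjf : f ≫ j = 0 := by simp [j]
  have h1 : f ≫ e.hom = (f ≫ e.hom ≫ biprod.snd) ≫ biprod.inr := by
    apply biprod.hom_ext
    · rw [Category.assoc, he, hjf]; simp
    · simp
  have h2 : Mono (f ≫ (e.hom ≫ biprod.snd)) := by
    have : Mono (f ≫ e.hom) := inferInstance
    rw [h1] at this
    exact mono_of_mono (f ≫ e.hom ≫ biprod.snd) (biprod.inr : Z ⟶ Q ⊞ Z)
  have h3 : Mono (e.hom ≫ biprod.snd) := h.essential _ _ h2
  rw [IsZero.iff_id_eq_zero]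
  have h4 : ((biprod.inl : Q ⟶ Q ⊞ Z) ≫ e.inv) ≫ (e.hom ≫ biprod.snd) =
      0 ≫ (e.hom ≫ biprod.snd) := by simp
  have h5 := (cancel_mono _).1 h4
  have h6 : ((biprod.inl : Q ⟶ Q ⊞ Z) ≫ e.inv) ≫ e.hom ≫ biprod.fst = 0 := by
    rw [h5]; simp
  simpa using h6

theorem IsCosyzygy.stabSyz [Frobenius C] {Y X : C} (h : IsCosyzygy X Y) : StabSyz Y X := by
  obtain ⟨I, f, hf, ⟨e⟩⟩ := h
  have := hf.mono
  exact StabSyz.congr ⟨I, f, _, _, (Frobenius.projective_iff_injective I).2 hf.injective,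
    shortExact_cokernel f⟩ (Iso.refl Y) e.symm

theorem ProjFree.congr {X Y : C} (e : X ≅ Y) (h : ProjFree X) : ProjFree Y :=
  fun Q hQ ⟨Z, ⟨e'⟩⟩ => h Q hQ ⟨Z, ⟨e ≪≫ e'⟩⟩

/-- In a short exact sequence with projective middle term whose quotient has no projective
summand, the monomorphism is an injective hull. -/
theorem isInjectiveHull_of_shortExact [KrullSchmidt C] [Frobenius C] {Y P X : C} {i : Y ⟶ P}
    {f : P ⟶ X} {w : i ≫ f = 0} (hS : (ShortComplex.mk i f w).ShortExact) (hP : Projective P)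
    (hX : ProjFree X) : IsInjectiveHull i := by
  have hmono := hS.mono_f
  have hepi := hS.epi_g
  dsimp at hmono hepi
  have hI : Injective P := (Frobenius.projective_iff_injective P).1 hP
  refine ⟨hI, hmono, fun Z g hg => ?_⟩
  let h := Injective.factorThru i (i ≫ g)
  have hh : (i ≫ g) ≫ h = i := Injective.comp_factorThru _ _
  let a : End P := g ≫ h
  have ha : ∀ m : ℕ, i ≫ (show P ⟶ P from a ^ m) = i := by
    intro m
    induction m with
    | zero => exact Category.comp_id i
    | succ m ihm =>
      change i ≫ (a ≫ (show P ⟶ P from a ^ m)) = i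
      have : i ≫ a = i := by
        change i ≫ g ≫ h = i
        rw [← Category.assoc, hh]
      rw [reassoc_of% this, ihm]
  -- Since `a` fixes `i`, the idempotent `1 - e` kills `i` and factors through `f`. Its image is
  -- then a projective summand of `X`, hence zero; so `a` is invertible and `g` is a split
  -- monomorphism.
  obtain ⟨e, b, he, hab, hba, m, hm⟩ := KrullSchmidt.fitting a
  have hcomm : (1 - e) * a ^ m = 0 := by
    have : Commute e a := by
      change e * a = a * e
      calc e * a = a * b * a := by rw [← hab]
        _ = a * (b * a) := mul_assoc _ _ _
        _ = a * e := by rw [← hba]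
    rw [((Commute.one_left _).sub_left (this.pow_right m)).eq, hm]
  have hie : i ≫ (show P ⟶ P from (1 - e : End P)) = 0 := by
    have : (show P ⟶ P from a ^ m) ≫ (show P ⟶ P from (1 - e : End P)) = 0 := hcomm
    rw [← ha m, Category.assoc, this, comp_zero]
  obtain ⟨t, ht⟩ := hS.exact.desc' _ hie
  dsimp at t ht
  have hidem : (1 - e) * (1 - e) = 1 - e := by
    rw [mul_sub, sub_mul, sub_mul, he]; simp
  obtain ⟨Q, j, r, hjr, hrj⟩ := IsIdempotentComplete.idempotents_split P _ hidem
  have hQ : Projective Q := Retract.projective ⟨j, r, hjr⟩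
  have hQX : (j ≫ f) ≫ (t ≫ r) = 𝟙 Q := by
    have : (j ≫ f) ≫ (t ≫ r) = j ≫ (f ≫ t) ≫ r := by simp
    rw [this, ht]
    change j ≫ (show P ⟶ P from (1 - e : End P)) ≫ r = 𝟙 Q
    rw [← hrj]
    simp [hjr]
  have hQ0 := hX Q hQ (isSummand_of_retract _ _ hQX)
  have he1 : (1 : End P) = e := by
    have : (show P ⟶ P from (1 - e : End P)) = 0 := by rw [← hrj, hQ0.eq_of_tgt r 0, zero_comp]
    exact sub_eq_zero.1 this
  have hgh : g ≫ (h ≫ (show P ⟶ P from b)) = 𝟙 P := by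
    rw [← Category.assoc]
    exact (he1.trans hba).symm
  exact (⟨⟨_, hgh⟩⟩ : IsSplitMono g).mono

/-- Both sides are the kernel of `P ⊞ P' ⟶ X`. The dual below needs projectives to be injective. -/
theorem stabSyz_schanuel {Y X Y' : C} (h : StabSyz Y X) (h' : StabSyz Y' X) :
    ∃ P P' : C, Projective P ∧ Projective P' ∧ Nonempty (Y ⊞ P' ≅ Y' ⊞ P) := by
  obtain ⟨P, i, f, w, hP, hS⟩ := h
  obtain ⟨P', i', f', w', hP', hS'⟩ := h'
  have := hS.epi_g
  have := hS'.epi_g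
  dsimp at *
  refine ⟨P, P', hP, hP', ?_⟩
  obtain ⟨e⟩ := nonempty_kernel_desc_iso hS (Projective.factorThru f' f) f'
    (Projective.factorThru_comp _ _)
  obtain ⟨e'⟩ := nonempty_kernel_desc_iso hS' (Projective.factorThru f f') f
    (Projective.factorThru_comp _ _)
  refine ⟨e.symm ≪≫ kernel.mapIso _ _ (biprod.braiding P P') (Iso.refl X) ?_ ≪≫ e'⟩
  apply biprod.hom_ext' <;> simp

theorem stabSyz_schanuel' [Frobenius C] {Y X X' : C} (h : StabSyz Y X) (h' : StabSyz Y X') :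
    ∃ P P' : C, Projective P ∧ Projective P' ∧ Nonempty (X ⊞ P' ≅ X' ⊞ P) := by
  obtain ⟨P, i, f, w, hP, hS⟩ := h
  obtain ⟨P', i', f', w', hP', hS'⟩ := h'
  have := hS.mono_f
  have := hS'.mono_f
  dsimp at *
  have hI := (Frobenius.projective_iff_injective P).1 hP
  have hI' := (Frobenius.projective_iff_injective P').1 hP'
  refine ⟨P, P', hP, hP', ?_⟩
  obtain ⟨e⟩ := nonempty_cokernel_lift_iso hS (Injective.factorThru i' i) i'
    (Injective.comp_factorThru _ _)
  obtain ⟨e'⟩ := nonempty_cokernel_lift_iso hS' (Injective.factorThru i i') i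
    (Injective.comp_factorThru _ _)
  refine ⟨e.symm ≪≫ cokernel.mapIso _ _ (Iso.refl Y) (biprod.braiding P P') ?_ ≪≫ e'⟩
  apply biprod.hom_ext <;> simp

theorem exists_stabSyz [Frobenius C] (X : C) : ∃ Y : C, StabSyz Y X := by
  obtain ⟨P, f, hf⟩ := Frobenius.exists_isProjectiveCover X
  exact ⟨kernel f, IsSyzygy.stabSyz ⟨P, f, hf, ⟨Iso.refl _⟩⟩⟩

theorem exists_stabSyz' [Frobenius C] (Y : C) : ∃ X : C, StabSyz Y X := by
  obtain ⟨I, i, hI, hi⟩ := Frobenius.exists_mono_injective Y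
  exact ⟨cokernel i, I, i, _, _, (Frobenius.projective_iff_injective I).2 hI,
    shortExact_cokernel i⟩

theorem IsNonprojIndec.projFree {X : C} (h : IsNonprojIndec X) : ProjFree X := by
  intro Q hQ hs
  by_contra hQ0
  obtain ⟨Z, ⟨e⟩⟩ := hs
  have hZ := (h.1.2 Q Z e).resolve_left hQ0
  exact h.2 (Projective.of_iso (e ≪≫ (isoBiprodZero hZ).symm).symm hQ)

/-- Stated for a general relation so as to serve both `Ω` and `Ω⁻¹`. -/
theorem iterateRel_iff {R : C → C → Prop} {σ : Equiv.Perm (NPClass C)}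
    (hR : ∀ {X Y : C} {q : NPClass C}, isoClass X = q.1 → (R Y X ↔ isoClass Y = (σ q).1))
    (n : ℕ) {X : C} {q : NPClass C} (hX : isoClass X = q.1) :
    ∀ {Y : C}, IterateRel R n Y X ↔ isoClass Y = ((σ ^ n) q).1 := by
  induction n with
  | zero =>
    intro Y
    rw [pow_zero, Equiv.Perm.one_apply, ← hX, isoClass_eq_iff]
    rfl
  | succ n ih =>
    intro Y
    rw [pow_succ', Equiv.Perm.mul_apply]
    constructor
    · rintro ⟨Z, hZ, hY⟩
      exact (hR (ih.1 hZ)).1 hY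
    · intro h
      obtain ⟨Z, hZ⟩ := ((σ ^ n) q).1.exists_rep
      exact ⟨Z, ih.2 hZ, (hR hZ).2 h⟩

variable [KrullSchmidt C]

theorem npSummands_eq_of_stabSyz {Y X Y' : C} (h : StabSyz Y X) (h' : StabSyz Y' X) :
    npSummands Y = npSummands Y' := by
  obtain ⟨P, P', hP, hP', ⟨e⟩⟩ := stabSyz_schanuel h h'
  have := npSummands_congr e
  rwa [npSummands_biprod, npSummands_biprod, npSummands_of_projective hP,
    npSummands_of_projective hP', add_zero, add_zero] at this

theorem card_npSummands_of_indecomposable {A : C} (hA : Indecomposable A) :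
    Projective A ∧ npSummands A = 0 ∨
      ¬ Projective A ∧ Multiset.card (npSummands A) = 1 := by
  by_cases h : Projective A
  · exact Or.inl ⟨h, npSummands_of_projective h⟩
  · right
    rw [npSummands_of_isNonprojIndec ⟨hA, h⟩]
    exact ⟨h, rfl⟩

theorem StabSyz.projective_left {Y X : C} (h : StabSyz Y X) (hX : Projective X) :
    Projective Y := by
  apply projective_of_npSummands_eq_zero
  rw [npSummands_eq_of_stabSyz h (StabSyz.of_projective_right hX (isZero_zero C)),
    npSummands_of_isZero (isZero_zero C)]

variable [Frobenius C]

theorem npSummands_eq_of_stabSyz' {Y X X' : C} (h : StabSyz Y X) (h' : StabSyz Y X') :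
    npSummands X = npSummands X' := by
  obtain ⟨P, P', hP, hP', ⟨e⟩⟩ := stabSyz_schanuel' h h'
  have := npSummands_congr e
  rwa [npSummands_biprod, npSummands_biprod, npSummands_of_projective hP,
    npSummands_of_projective hP', add_zero, add_zero] at this

theorem StabSyz.projective_right {Y X : C} (h : StabSyz Y X) (hY : Projective Y) :
    Projective X := by
  apply projective_of_npSummands_eq_zero
  rw [npSummands_eq_of_stabSyz' h (StabSyz.of_projective hY (isZero_zero C)),
    npSummands_of_isZero (isZero_zero C)]

/-- A syzygy of a non-projective object is non-projective, so each non-projective summand of `X`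
accounts for at least one of `Y`. With the dual inequality, a syzygy of a non-projective
indecomposable has exactly one non-projective indecomposable summand. -/
theorem card_npSummands_le {X : C} : ∀ {Y : C}, StabSyz Y X →
    Multiset.card (npSummands X) ≤ Multiset.card (npSummands Y) := by
  induction X using indec_induction with
  | hiso X X' e h =>
    intro Y hY
    rw [← npSummands_congr e]
    exact h (hY.congr (Iso.refl Y) e.symm)
  | hzero X h =>
    intro Y _
    rw [npSummands_of_isZero h]
    exact Nat.zero_le _
  | hcons A Z hA h =>
    intro Y hY
    obtain ⟨B, hB⟩ := exists_stabSyz A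
    obtain ⟨W, hW⟩ := exists_stabSyz Z
    rw [npSummands_eq_of_stabSyz hY (hB.biprod hW), npSummands_biprod, npSummands_biprod,
      Multiset.card_add, Multiset.card_add]
    refine Nat.add_le_add ?_ (h hW)
    rcases card_npSummands_of_indecomposable hA with ⟨h1, h2⟩ | ⟨h1, h2⟩
    · rw [h2]; exact Nat.zero_le _
    · rw [h2, Nat.one_le_iff_ne_zero, Ne, Multiset.card_eq_zero]
      exact fun h3 => h1 (hB.projective_right (projective_of_npSummands_eq_zero h3))

theorem card_npSummands_le' {Y : C} : ∀ {X : C}, StabSyz Y X →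
    Multiset.card (npSummands Y) ≤ Multiset.card (npSummands X) := by
  induction Y using indec_induction with
  | hiso Y Y' e h =>
    intro X hX
    rw [← npSummands_congr e]
    exact h (hX.congr e.symm (Iso.refl X))
  | hzero X h =>
    intro Y _
    rw [npSummands_of_isZero h]
    exact Nat.zero_le _
  | hcons A Z hA h =>
    intro Y hY
    obtain ⟨B, hB⟩ := exists_stabSyz' A
    obtain ⟨W, hW⟩ := exists_stabSyz' Z
    rw [npSummands_eq_of_stabSyz' hY (hB.biprod hW), npSummands_biprod, npSummands_biprod,
      Multiset.card_add, Multiset.card_add]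
    refine Nat.add_le_add ?_ (h hW)
    rcases card_npSummands_of_indecomposable hA with ⟨h1, h2⟩ | ⟨h1, h2⟩
    · rw [h2]; exact Nat.zero_le _
    · rw [h2, Nat.one_le_iff_ne_zero, Ne, Multiset.card_eq_zero]
      exact fun h3 => h1 (hB.projective_left (projective_of_npSummands_eq_zero h3))

theorem StabSyz.card_npSummands {Y X : C} (h : StabSyz Y X) :
    Multiset.card (npSummands Y) = Multiset.card (npSummands X) :=
  le_antisymm (card_npSummands_le' h) (card_npSummands_le h)

theorem exists_omega_class (q : NPClass C) :
    ∃ q' : NPClass C, ∀ X Y : C, isoClass X = q.1 → StabSyz Y X → npSummands Y = {q'} := by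
  obtain ⟨A, hA, rfl⟩ := q.exists_rep
  obtain ⟨B, hB⟩ := exists_stabSyz A
  have h := hB.card_npSummands
  rw [npSummands_of_isNonprojIndec hA, Multiset.card_singleton, Multiset.card_eq_one] at h
  obtain ⟨q', hq'⟩ := h
  refine ⟨q', fun X Y hX hY => ?_⟩
  obtain ⟨e⟩ := isoClass_eq_iff.1 hX
  rw [npSummands_eq_of_stabSyz (hY.congr (Iso.refl Y) e) hB, hq']

theorem exists_omega_inv_class (q : NPClass C) :
    ∃ q' : NPClass C, ∀ X Y : C, isoClass Y = q.1 → StabSyz Y X → npSummands X = {q'} := by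
  obtain ⟨A, hA, rfl⟩ := q.exists_rep
  obtain ⟨B, hB⟩ := exists_stabSyz' A
  have h := hB.card_npSummands
  rw [npSummands_of_isNonprojIndec hA, Multiset.card_singleton, eq_comm,
    Multiset.card_eq_one] at h
  obtain ⟨q', hq'⟩ := h
  refine ⟨q', fun X Y hX hY => ?_⟩
  obtain ⟨e⟩ := isoClass_eq_iff.1 hX
  rw [npSummands_eq_of_stabSyz' (hY.congr e (Iso.refl X)) hB, hq']

variable (C) in
/-- The permutation of the classes of non-projective indecomposable objects induced by `Ω`. -/
def omegaPerm : Equiv.Perm (NPClass C) where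
  toFun q := (exists_omega_class q).choose
  invFun q := (exists_omega_inv_class q).choose
  left_inv q := by
    obtain ⟨A, hA, rfl⟩ := q.exists_rep
    obtain ⟨P, f, hf⟩ := Frobenius.exists_isProjectiveCover A
    have hs : StabSyz (kernel f) A := IsSyzygy.stabSyz ⟨P, f, hf, ⟨Iso.refl _⟩⟩
    have h1 := (exists_omega_class (npClass A hA)).choose_spec A _ rfl hs
    have h2 := isNonprojIndec_of_npSummands_eq_singleton hf.projFree_kernel h1
    have h3 := (exists_omega_inv_class _).choose_spec A _ h2 hs
    rw [npSummands_of_isNonprojIndec hA, Multiset.singleton_inj] at h3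
    exact h3.symm
  right_inv q := by
    obtain ⟨A, hA, rfl⟩ := q.exists_rep
    obtain ⟨X, hX⟩ := exists_stabSyz' A
    have h1 := (exists_omega_inv_class (npClass A hA)).choose_spec X A rfl hX
    -- `X` is a cokernel without any minimality, so a projective summand `Z` may have to be removed
    -- to reach a representative `X'`.
    have h0 := exists_isSummand_of_mem_npSummands (h1 ▸ Multiset.mem_singleton_self _)
    obtain ⟨X', hX', hq, Z, ⟨e⟩⟩ := h0
    have hZ : Projective Z := by
      apply projective_of_npSummands_eq_zero
      rw [npSummands_congr e, npSummands_biprod, npSummands_of_isNonprojIndec hX', hq] at h1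
      exact add_eq_left.1 h1
    obtain ⟨Y, hY⟩ := exists_stabSyz X'
    have h2 := npSummands_eq_of_stabSyz (hX.congr (Iso.refl A) e)
      (hY.biprod (StabSyz.of_projective_right hZ (isZero_zero C)))
    rw [npSummands_biprod, npSummands_of_isZero (isZero_zero C), add_zero,
      npSummands_of_isNonprojIndec hA] at h2
    have h3 := (exists_omega_class _).choose_spec X' Y (congrArg Subtype.val hq) hY
    rw [← h2, Multiset.singleton_inj] at h3
    exact h3.symm

theorem npSummands_of_stabSyz_of_isoClass {X Y : C} {q : NPClass C} (hX : isoClass X = q.1)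
    (h : StabSyz Y X) : npSummands Y = {omegaPerm C q} :=
  (exists_omega_class q).choose_spec X Y hX h

theorem npSummands_of_stabSyz {X : C} : ∀ {Y : C}, StabSyz Y X →
    npSummands Y = (npSummands X).map (omegaPerm C) := by
  induction X using indec_induction with
  | hiso X X' e h =>
    intro Y hY
    rw [← npSummands_congr e]
    exact h (hY.congr (Iso.refl Y) e.symm)
  | hzero X h =>
    intro Y hY
    rw [npSummands_of_isZero h, npSummands_of_projective, Multiset.map_zero]
    exact hY.projective_left (Projective.of_iso (h.iso (isZero_zero C)).symm inferInstance)
  | hcons A Z hA h =>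
    intro Y hY
    obtain ⟨B, hB⟩ := exists_stabSyz A
    obtain ⟨W, hW⟩ := exists_stabSyz Z
    rw [npSummands_eq_of_stabSyz hY (hB.biprod hW), npSummands_biprod, npSummands_biprod,
      Multiset.map_add, h hW]
    congr 1
    by_cases hP : Projective A
    · rw [npSummands_of_projective hP, npSummands_of_projective (hB.projective_left hP),
        Multiset.map_zero]
    · rw [npSummands_of_isNonprojIndec ⟨hA, hP⟩, Multiset.map_singleton]
      exact npSummands_of_stabSyz_of_isoClass rfl hB

/-- Minimality of the cover leaves no projective summand in the kernel, so the stable class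
determines the kernel itself. -/
theorem isSyzygy_iff {X Y : C} {q : NPClass C} (hX : isoClass X = q.1) :
    IsSyzygy Y X ↔ isoClass Y = (omegaPerm C q).1 := by
  have key : ∀ {Y : C}, IsSyzygy Y X → isoClass Y = (omegaPerm C q).1 := by
    intro Y h
    refine isNonprojIndec_of_npSummands_eq_singleton ?_
      (npSummands_of_stabSyz_of_isoClass hX h.stabSyz)
    obtain ⟨P, f, hf, ⟨e⟩⟩ := h
    exact hf.projFree_kernel.congr e.symm
  refine ⟨key, fun h => ?_⟩
  obtain ⟨P, f, hf⟩ := Frobenius.exists_isProjectiveCover X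
  obtain ⟨e⟩ := isoClass_eq_iff.1 (h.trans (key ⟨P, f, hf, ⟨Iso.refl _⟩⟩).symm)
  exact ⟨P, f, hf, ⟨e⟩⟩

/-- For the converse, the projective cover sequence of `Y` is read from the other end: as `Y` has no
projective summand, its monomorphism is an injective hull of `X`. -/
theorem isCosyzygy_iff {X Y : C} {q : NPClass C} (hX : isoClass X = q.1) :
    IsCosyzygy Y X ↔ isoClass Y = ((omegaPerm C)⁻¹ q).1 := by
  constructor
  · intro h
    have h1 := npSummands_of_stabSyz h.stabSyz
    have hX' := q.isNonprojIndec hX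
    have hq : npClass X hX' = q := Subtype.ext hX
    rw [npSummands_of_isNonprojIndec hX', hq, eq_comm, Multiset.map_eq_singleton] at h1
    obtain ⟨y, hy, hyq⟩ := h1
    rw [← hyq, Equiv.Perm.inv_def, Equiv.symm_apply_apply]
    refine isNonprojIndec_of_npSummands_eq_singleton ?_ hy
    obtain ⟨P, f, hf, ⟨e⟩⟩ := h
    exact hf.projFree_cokernel.congr e.symm
  · intro h
    have hY := NPClass.isNonprojIndec _ h
    have h1 : IsSyzygy X Y := by
      rw [isSyzygy_iff h, Equiv.Perm.inv_def, Equiv.apply_symm_apply, hX]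
    obtain ⟨P, f, hf, ⟨e⟩⟩ := h1
    have := hf.epi
    have hS : (ShortComplex.mk (e.hom ≫ kernel.ι f) f (by simp)).ShortExact :=
      ShortComplex.shortExact_of_iso
        (ShortComplex.isoMk e.symm (Iso.refl P) (Iso.refl Y) (by simp) (by simp))
        (shortExact_kernel f)
    refine ⟨P, _, isInjectiveHull_of_shortExact hS hf.projective hY.projFree, ⟨?_⟩⟩
    exact hS.gIsCokernel.coconePointUniqueUpToIso (colimit.isColimit _)

theorem isOmegaPow_iff (a : ℤ) {X Y : C} {q : NPClass C} (hX : isoClass X = q.1) :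
    IsOmegaPow a Y X ↔ isoClass Y = ((omegaPerm C ^ a) q).1 := by
  cases a with
  | ofNat n => exact iterateRel_iff isSyzygy_iff n hX
  | negSucc n =>
    rw [zpow_negSucc, ← inv_pow]
    exact iterateRel_iff isCosyzygy_iff (n + 1) hX

theorem inOmegaOrbit_iff {X Y : C} {x y : NPClass C} (hX : isoClass X = x.1)
    (hY : isoClass Y = y.1) : InOmegaOrbit X Y ↔ (omegaPerm C).SameCycle y x := by
  refine exists_congr fun a => ?_
  rw [isOmegaPow_iff a hY, hX, Subtype.ext_iff, eq_comm]

theorem InOmegaOrbit.isNonprojIndec {X Y : C} (hY : IsNonprojIndec Y) (h : InOmegaOrbit X Y) :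
    IsNonprojIndec X := by
  obtain ⟨a, h⟩ := h
  rw [isOmegaPow_iff a (q := npClass Y hY) rfl] at h
  exact NPClass.isNonprojIndec _ h

variable (C) in
/-- The `Ω`-orbits of classes of non-projective indecomposable objects. -/
abbrev OmegaOrbit : Type u := Quotient (Equiv.Perm.SameCycle.setoid (omegaPerm C))

/-- The `Ω`-orbit of a class. -/
def NPClass.orbit (q : NPClass C) : OmegaOrbit C := Quotient.mk _ q

theorem NPClass.orbit_eq_iff {x y : NPClass C} :
    x.orbit = y.orbit ↔ (omegaPerm C).SameCycle x y :=
  Quotient.eq (r := Equiv.Perm.SameCycle.setoid (omegaPerm C))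

theorem inOmegaOrbit_iff_orbit_eq {X Y : C} (hX : IsNonprojIndec X) (hY : IsNonprojIndec Y) :
    InOmegaOrbit X Y ↔ (npClass X hX).orbit = (npClass Y hY).orbit := by
  rw [inOmegaOrbit_iff (x := npClass X hX) (y := npClass Y hY) rfl rfl, eq_comm,
    NPClass.orbit_eq_iff]

theorem NPClass.orbit_zpow (a : ℤ) (q : NPClass C) : ((omegaPerm C ^ a) q).orbit = q.orbit :=
  NPClass.orbit_eq_iff.2 (Equiv.Perm.sameCycle_zpow_left.2 (Equiv.Perm.SameCycle.refl _ _))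

/-- The multiset of `Ω`-orbits of the non-projective indecomposable summands of an object. -/
def orbits (X : C) : Multiset (OmegaOrbit C) := (npSummands X).map NPClass.orbit

theorem orbits_congr {X Y : C} (e : X ≅ Y) : orbits X = orbits Y := by
  rw [orbits, npSummands_congr e, orbits]

theorem orbits_biprod (X Y : C) : orbits (X ⊞ Y) = orbits X + orbits Y := by
  rw [orbits, npSummands_biprod, Multiset.map_add]
  rfl

theorem orbits_of_projective {X : C} (h : Projective X) : orbits X = 0 := by
  rw [orbits, npSummands_of_projective h]
  rfl

theorem orbits_of_stabSyz {X Y : C} (h : StabSyz Y X) : orbits Y = orbits X := by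
  rw [orbits, npSummands_of_stabSyz h, Multiset.map_map]
  refine Multiset.map_congr rfl fun q _ => ?_
  have := NPClass.orbit_zpow 1 q
  rwa [zpow_one] at this

end Frobenius

/-! ### Relative traces and induction from the trivial group. -/

section Trace

variable {V : Type u} [Category.{v} V] [Preadditive V] {G : Type w} [Group G] [Fintype G]

/-- The relative trace of a morphism between the underlying objects. -/
def relTrace {X Y : Action V G} (α : X.V ⟶ Y.V) : X ⟶ Y where
  hom := ∑ g : G, X.ρ g⁻¹ ≫ α ≫ Y.ρ g
  comm h := by
    rw [Preadditive.comp_sum, Preadditive.sum_comp, ← Equiv.sum_comp (Equiv.mulLeft h)]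
    refine Finset.sum_congr rfl fun g _ => ?_
    have h1 : X.ρ h ≫ X.ρ (h * g)⁻¹ = X.ρ g⁻¹ := by
      rw [← End.mul_def, ← map_mul]
      congr 1
      group
    have h2 : Y.ρ (h * g) = Y.ρ g ≫ Y.ρ h := by rw [map_mul, End.mul_def]
    rw [Equiv.coe_mulLeft, reassoc_of% h1, h2]
    simp

theorem relTrace_comp {X Y Z : Action V G} (α : X.V ⟶ Y.V) (f : Y ⟶ Z) :
    relTrace α ≫ f = relTrace (α ≫ f.hom) := by
  ext
  simp [relTrace, Preadditive.sum_comp, f.comm]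

theorem comp_relTrace {X Y Z : Action V G} (f : X ⟶ Y) (α : Y.V ⟶ Z.V) :
    f ≫ relTrace α = relTrace (f.hom ≫ α) := by
  ext
  simp [relTrace, Preadditive.comp_sum, ← f.comm_assoc]

/-- Higman's criterion: the identity is a relative trace. -/
def IsTraceId (X : Action V G) : Prop := ∃ α : X.V ⟶ X.V, relTrace α = 𝟙 X

theorem IsTraceId.of_retract {X Y : Action V G} (h : IsTraceId X) (i : Y ⟶ X) (r : X ⟶ Y)
    (hir : i ≫ r = 𝟙 Y) : IsTraceId Y := by
  obtain ⟨α, hα⟩ := h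
  refine ⟨i.hom ≫ α ≫ r.hom, ?_⟩
  rw [← comp_relTrace, ← relTrace_comp, hα, Category.id_comp, hir]

variable [HasFiniteBiproducts V]

/-- Left translation on the direct sum of copies of an object indexed by a group. -/
def translate (W : V) (g : G) : (⨁ fun _ : G => W) ⟶ ⨁ fun _ : G => W :=
  biproduct.lift fun h => biproduct.π (fun _ : G => W) (g⁻¹ * h)

theorem translate_π (W : V) (g h : G) :
    translate W g ≫ biproduct.π (fun _ : G => W) h = biproduct.π (fun _ : G => W) (g⁻¹ * h) :=
  biproduct.lift_π _ _

open scoped Classical in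
theorem ι_translate (W : V) (g h : G) :
    biproduct.ι (fun _ : G => W) h ≫ translate W g = biproduct.ι (fun _ : G => W) (g * h) := by
  apply biproduct.hom_ext
  intro j
  rw [Category.assoc, translate_π]
  by_cases hj : g * h = j
  · subst hj
    rw [inv_mul_cancel_left, biproduct.ι_π_self, biproduct.ι_π_self]
  · rw [biproduct.ι_π_ne _ hj, biproduct.ι_π_ne]
    exact fun h1 => hj (mul_eq_of_eq_inv_mul h1)

variable (G) in
/-- The object induced from the trivial group. -/
def inducedObj (W : V) : Action V G where
  V := ⨁ fun _ : G => W
  ρ :=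
    { toFun := fun g => translate W g
      map_one' := by
        apply biproduct.hom_ext
        intro h
        rw [translate_π, inv_one, one_mul, End.one_def, Category.id_comp]
      map_mul' := fun g g' => by
        rw [End.mul_def]
        apply biproduct.hom_ext
        intro h
        rw [translate_π, Category.assoc, translate_π, translate_π, mul_inv_rev, mul_assoc] }

-- The endomorphism is the projection to the copy indexed by `1`. Its conjugate by `g` is the
-- projection to the copy indexed by `g`, and these sum to the identity.
open scoped Classical in
theorem isTraceId_inducedObj (W : V) : IsTraceId (inducedObj G W) := by
  let F : G → V := fun _ => W
  refine ⟨biproduct.π F 1 ≫ biproduct.ι F 1, ?_⟩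
  ext
  have h : ∀ g : G, translate W g⁻¹ ≫ (biproduct.π F 1 ≫ biproduct.ι F 1) ≫ translate W g =
      biproduct.π F g ≫ biproduct.ι F g := by
    intro g
    rw [Category.assoc, ι_translate, ← Category.assoc, translate_π, inv_inv, mul_one]
  refine (Finset.sum_congr rfl fun g _ => h g).trans ?_
  apply biproduct.hom_ext
  intro j
  rw [Preadditive.sum_comp, Finset.sum_eq_single j]
  · rw [Category.assoc, biproduct.ι_π_self, Category.comp_id]
    exact (Category.id_comp _).symm
  · intro g _ hg
    rw [Category.assoc, biproduct.ι_π_ne _ hg, comp_zero]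
  · exact fun h => absurd (Finset.mem_univ j) h

/-- The counit of induction. -/
def inducedDesc (X : Action V G) : inducedObj G X.V ⟶ X where
  hom := biproduct.desc fun g : G => X.ρ g
  comm h := by
    classical
    change translate X.V h ≫ biproduct.desc (fun g : G => X.ρ g) =
      biproduct.desc (fun g : G => X.ρ g) ≫ X.ρ h
    apply biproduct.hom_ext'
    intro j
    rw [← Category.assoc, ι_translate, biproduct.ι_desc, ← Category.assoc, biproduct.ι_desc,
      map_mul, End.mul_def]

/-- The unit of coinduction. -/
def inducedLift (X : Action V G) : X ⟶ inducedObj G X.V where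
  hom := biproduct.lift fun g : G => X.ρ g⁻¹
  comm h := by
    change X.ρ h ≫ biproduct.lift (fun g : G => X.ρ g⁻¹) =
      biproduct.lift (fun g : G => X.ρ g⁻¹) ≫
        translate X.V h
    apply biproduct.hom_ext
    intro j
    rw [Category.assoc, Category.assoc, translate_π, biproduct.lift_π, biproduct.lift_π,
      ← End.mul_def, ← map_mul, mul_inv_rev, inv_inv]

instance epi_inducedDesc (X : Action V G) : Epi (inducedDesc X) := by
  have h : biproduct.ι (fun _ : G => X.V) 1 ≫ (inducedDesc X).hom = 𝟙 X.V := by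
    change _ ≫ biproduct.desc _ = _
    rw [biproduct.ι_desc, map_one]
    rfl
  have : IsSplitEpi (inducedDesc X).hom := ⟨⟨_, h⟩⟩
  have : Epi ((Action.forget V G).map (inducedDesc X)) :=
    inferInstanceAs (Epi (inducedDesc X).hom)
  exact (Action.forget V G).epi_of_epi_map this

instance mono_inducedLift (X : Action V G) : Mono (inducedLift X) := by
  have h : (inducedLift X).hom ≫ biproduct.π (fun _ : G => X.V) 1 = 𝟙 X.V := by
    change biproduct.lift _ ≫ _ = _
    rw [biproduct.lift_π, inv_one, map_one]
    rfl
  have : IsSplitMono (inducedLift X).hom := ⟨⟨_, h⟩⟩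
  have : Mono ((Action.forget V G).map (inducedLift X)) :=
    inferInstanceAs (Mono (inducedLift X).hom)
  exact (Action.forget V G).mono_of_mono_map this

end Trace

/-! ### Representations: tensor products, projectivity and the trivial module. -/

section Rep

variable {k : Type u} [Field k] {G : Type v} [Group G]

theorem FGModuleCat.exists_section {A B : FGModuleCat.{u} k} (f : A ⟶ B) [Epi f] :
    ∃ s : B ⟶ A, s ≫ f = 𝟙 B := by
  have : Epi ((forget₂ (FGModuleCat k) (ModuleCat k)).map f) := inferInstance
  have hs := (ModuleCat.epi_iff_surjective _).1 this
  obtain ⟨s, hs⟩ := f.hom.hom.exists_rightInverse_of_surjective (LinearMap.range_eq_top.2 hs)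
  refine ⟨FGModuleCat.ofHom s, ?_⟩
  ext x
  exact LinearMap.congr_fun hs x

theorem FGModuleCat.exists_retraction {A B : FGModuleCat.{u} k} (f : A ⟶ B) [Mono f] :
    ∃ r : B ⟶ A, f ≫ r = 𝟙 A := by
  have : Mono ((forget₂ (FGModuleCat k) (ModuleCat k)).map f) := inferInstance
  have hs := (ModuleCat.mono_iff_injective _).1 this
  obtain ⟨s, hs⟩ := f.hom.hom.exists_leftInverse_of_injective (LinearMap.ker_eq_bot.2 hs)
  refine ⟨FGModuleCat.ofHom s, ?_⟩
  ext x
  exact LinearMap.congr_fun hs x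

theorem not_isZero_unit : ¬ IsZero (𝟙_ (FDRep k G)) := by
  intro h
  have h1 : (𝟙 (𝟙_ (FDRep k G))) = 0 := h.eq_of_src _ _
  have h2 : (𝟙 (𝟙_ (FGModuleCat k))) = 0 := congrArg Action.Hom.hom h1
  have h3 := congrArg (fun f : (𝟙_ (FGModuleCat k)) ⟶ 𝟙_ (FGModuleCat k) => f.hom.hom (1 : k)) h2
  exact one_ne_zero (α := k) h3

/-- Evaluation at `1` bounds the dimension of the endomorphism ring by one, while two nonzero
summands would need at least two. -/
theorem indecomposable_unit : Indecomposable (𝟙_ (FDRep k G)) := by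
  refine ⟨not_isZero_unit, fun Y Z e => ?_⟩
  by_contra! h
  have h1 := finrank_end_add_le k e
  have h2 := finrank_end_pos k h.1
  have h3 := finrank_end_pos k h.2
  let φ : (𝟙_ (FDRep k G) ⟶ 𝟙_ (FDRep k G)) →ₗ[k] k :=
    { toFun := fun f => f.hom.hom.hom (1 : k)
      map_add' := fun _ _ => rfl
      map_smul' := fun _ _ => rfl }
  have hφ : Function.Injective φ := by
    intro f g hfg
    ext : 3
    exact hfg
  have h4 := LinearMap.finrank_le_finrank_of_injective hφ
  rw [Module.finrank_self] at h4
  omega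

/-- Tensoring with the dual is right adjoint to tensoring. -/
def tensorLeftAdj (M : FDRep k G) :
    MonoidalCategory.tensorLeft M ⊣ MonoidalCategory.tensorLeft Mᘁ :=
  letI : ExactPairing Mᘁ M := BraidedCategory.exactPairing_swap M Mᘁ
  tensorLeftAdjunction Mᘁ M

/-- Tensoring with the dual is left adjoint to tensoring. -/
def tensorLeftAdj' (M : FDRep k G) :
    MonoidalCategory.tensorLeft Mᘁ ⊣ MonoidalCategory.tensorLeft M :=
  tensorLeftAdjunction M Mᘁ

instance preservesLimits_tensorLeft (M : FDRep k G) :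
    PreservesFiniteLimits (MonoidalCategory.tensorLeft M) := by
  have := (tensorLeftAdj' M).rightAdjoint_preservesLimits
  infer_instance

instance preservesColimits_tensorLeft (M : FDRep k G) :
    PreservesFiniteColimits (MonoidalCategory.tensorLeft M) := by
  have := (tensorLeftAdj M).leftAdjoint_preservesColimits
  infer_instance

/-- The right adjoint, tensoring with the dual, is exact. -/
theorem projective_tensor (M : FDRep k G) {P : FDRep k G} (hP : Projective P) :
    Projective (M ⊗ P) :=
  (tensorLeftAdj M).map_projective P hP

theorem nonempty_tensor_biprod_iso (M X Y : FDRep k G) :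
    Nonempty (M ⊗ (X ⊞ Y) ≅ (M ⊗ X) ⊞ (M ⊗ Y)) :=
  have := preservesBinaryBiproducts_of_preservesBiproducts (MonoidalCategory.tensorLeft M)
  ⟨(MonoidalCategory.tensorLeft M).mapBiprod X Y⟩

theorem StabSyz.tensor (M : FDRep k G) {Y X : FDRep k G} (h : StabSyz Y X) :
    StabSyz (M ⊗ Y) (M ⊗ X) := by
  obtain ⟨P, i, f, w, hP, hS⟩ := h
  exact ⟨M ⊗ P, M ◁ i, M ◁ f, _, projective_tensor M hP,
    hS.map_of_exact (MonoidalCategory.tensorLeft M)⟩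

variable [Fintype G]

/-- Lift along a `k`-linear section and take the trace; equivariant maps pass through traces, so the
result is an equivariant lift. -/
theorem IsTraceId.projective {X : FDRep k G} (h : IsTraceId X) : Projective X := by
  obtain ⟨α, hα⟩ := h
  refine ⟨fun {A B} f e he => ?_⟩
  have : Epi e.hom := inferInstanceAs (Epi ((Action.forget (FGModuleCat k) G).map e))
  obtain ⟨s, hs⟩ := FGModuleCat.exists_section e.hom
  refine ⟨relTrace (α ≫ f.hom ≫ s), ?_⟩
  rw [relTrace_comp, Category.assoc, Category.assoc, hs, Category.comp_id, ← relTrace_comp, hα,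
    Category.id_comp]

theorem IsTraceId.injective {X : FDRep k G} (h : IsTraceId X) : Injective X := by
  obtain ⟨α, hα⟩ := h
  refine ⟨fun {A B} f e he => ?_⟩
  have : Mono e.hom := inferInstanceAs (Mono ((Action.forget (FGModuleCat k) G).map e))
  obtain ⟨s, hs⟩ := FGModuleCat.exists_retraction e.hom
  refine ⟨relTrace (s ≫ f.hom ≫ α), ?_⟩
  rw [comp_relTrace, reassoc_of% hs, ← comp_relTrace, hα, Category.comp_id]

/-- A projective is a retract of the induced object covering it. Injectives are treated dually, so
projectivity and injectivity are the same condition. -/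
theorem isTraceId_of_projective {X : FDRep k G} (h : Projective X) : IsTraceId X :=
  (isTraceId_inducedObj X.V).of_retract _ _ (Projective.factorThru_comp (𝟙 X) (inducedDesc X))

theorem isTraceId_of_injective {X : FDRep k G} (h : Injective X) : IsTraceId X :=
  (isTraceId_inducedObj X.V).of_retract _ _ (Injective.comp_factorThru (𝟙 X) (inducedLift X))

instance enoughProjectives_fdRep : EnoughProjectives (FDRep k G) where
  presentation X := ⟨
    { p := inducedObj G X.V
      f := inducedDesc X
      projective := (isTraceId_inducedObj X.V).projective
      epi := epi_inducedDesc X }⟩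

instance krullSchmidt_fdRep : KrullSchmidt (FDRep k G) := krullSchmidt_of_homFinite k

instance frobenius_fdRep : Frobenius (FDRep k G) where
  projective_iff_injective _ :=
    ⟨fun h => (isTraceId_of_projective h).injective, fun h => (isTraceId_of_injective h).projective⟩
  exists_isProjectiveCover := exists_isProjectiveCover k
  exists_mono_injective X := ⟨inducedObj G X.V, inducedLift X,
    (isTraceId_inducedObj X.V).injective, inferInstance⟩

/-- Maschke's theorem: the identity is the trace of `|G|⁻¹`. -/
theorem projective_of_card_ne_zero (h : (Fintype.card G : k) ≠ 0) (X : FDRep k G) :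
    Projective X := by
  refine IsTraceId.projective ⟨(Fintype.card G : k)⁻¹ • 𝟙 X.V, ?_⟩
  ext : 1
  change ∑ g : G, _ = 𝟙 X.V
  have h1 : ∀ g : G, Action.ρ X g⁻¹ ≫ ((Fintype.card G : k)⁻¹ • 𝟙 X.V) ≫ Action.ρ X g =
      (Fintype.card G : k)⁻¹ • 𝟙 X.V := by
    intro g
    rw [Linear.smul_comp, Linear.comp_smul, Category.id_comp, ← End.mul_def, ← map_mul,
      mul_inv_cancel, map_one, End.one_def]
  rw [Finset.sum_congr rfl fun g _ => h1 g, Finset.sum_const, Finset.card_univ,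
    ← Nat.cast_smul_eq_nsmul k, smul_smul, mul_inv_cancel₀ h, one_smul]

/-- On the trivial module the trace of `α` is `|G| • α = 0`, which cannot be the identity. -/
theorem isNonprojIndec_unit (h : (Fintype.card G : k) = 0) :
    IsNonprojIndec (𝟙_ (FDRep k G)) := by
  refine ⟨indecomposable_unit, fun hP => not_isZero_unit (k := k) (G := G) ?_⟩
  obtain ⟨α, hα⟩ := isTraceId_of_projective hP
  rw [IsZero.iff_id_eq_zero, ← hα]
  ext : 1
  change ∑ g : G, _ = 0
  have h1 : ∀ g : G, Action.ρ (𝟙_ (FDRep k G)) g⁻¹ ≫ α ≫ Action.ρ (𝟙_ (FDRep k G)) g = α := by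
    intro g
    rw [Action.tensorUnit_ρ, Action.tensorUnit_ρ]
    simp
  rw [Finset.sum_congr rfl fun g _ => h1 g, Finset.sum_const, Finset.card_univ,
    ← Nat.cast_smul_eq_nsmul k, h, zero_smul]

end Rep

/-! ### Multiset sums and the value of a Laurent polynomial at `Ω = 1`. -/

section Multisets

/-- Binding as an additive homomorphism. -/
def bindHom {α β : Type*} (φ : α → Multiset β) : Multiset α →+ Multiset β where
  toFun s := s.bind φ
  map_zero' := Multiset.zero_bind φ
  map_add' s t := Multiset.add_bind s t φ

theorem sum_filter_eq {α β : Type*} [Fintype β] [DecidableEq β] (f : α → β) (s : Multiset α) :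
    ∑ b, s.filter (fun a => f a = b) = s := by
  induction s using Multiset.induction_on with
  | empty => simp
  | cons a s ih =>
    have h : ∀ b, (a ::ₘ s).filter (fun a => f a = b) =
        (if f a = b then {a} else 0) + s.filter (fun a => f a = b) := by
      intro b
      rw [Multiset.filter_cons]
    rw [Finset.sum_congr rfl fun b _ => h b, Finset.sum_add_distrib, ih,
      Finset.sum_ite_eq, if_pos (Finset.mem_univ _), Multiset.singleton_add]

theorem sum_sigma_eq {A : Type*} [AddCommMonoid A] (t : ℕ[T;T⁻¹]) (f : ℤ → A) :
    ∑ x : (Σ a : t.coeff.support, Fin (t.coeff a)), f x.1 =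
      ∑ a ∈ t.coeff.support, t.coeff a • f a := by
  rw [Fintype.sum_sigma, ← Finset.sum_coe_sort t.coeff.support]
  simp

theorem eval₂_one_eq (t : ℕ[T;T⁻¹]) :
    LaurentPolynomial.eval₂ (Nat.castRingHom ℤ) (1 : ℤˣ) t =
      ((t.coeff.sum fun _ m => m : ℕ) : ℤ) := by
  induction t using LaurentPolynomial.induction_on' with
  | add p q hp hq =>
    rw [map_add, hp, hq, AddMonoidAlgebra.coeff_add, Finsupp.sum_add_index' (fun _ => rfl)
      (fun _ _ _ => rfl), Nat.cast_add]
  | C_mul_T n a =>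
    rw [LaurentPolynomial.eval₂_C_mul_T, ← LaurentPolynomial.single_eq_C_mul_T,
      AddMonoidAlgebra.coeff_single, Finsupp.sum_single_index rfl]
    simp

end Multisets

/-! ### Orbits and summands of Laurent polynomials applied to an object. -/

section Frobenius

variable {C : Type u} [Category.{v} C] [Abelian C] [KrullSchmidt C]

theorem indecClasses_biproduct {ι : Type} [Fintype ι] (N : ι → C) :
    indecClasses (⨁ N) = ∑ i, indecClasses (N i) :=
  map_biproduct_eq_sum indecClasses (fun _ _ => indecClasses_congr)
    (fun _ => indecClasses_of_isZero) indecClasses_biprod N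

variable [Frobenius C]

theorem orbits_of_isZero {X : C} (h : IsZero X) : orbits X = 0 := by
  rw [orbits, npSummands_of_isZero h]
  rfl

theorem orbits_biproduct {ι : Type} [Fintype ι] (N : ι → C) :
    orbits (⨁ N) = ∑ i, orbits (N i) :=
  map_biproduct_eq_sum orbits (fun _ _ => orbits_congr) (fun _ => orbits_of_isZero)
    orbits_biprod N

theorem orbits_of_isNonprojIndec {X : C} (h : IsNonprojIndec X) :
    orbits X = {(npClass X h).orbit} := by
  rw [orbits, npSummands_of_isNonprojIndec h, Multiset.map_singleton]

theorem IsLaurentApply.orbits_eq {t : ℕ[T;T⁻¹]} {Y N : C} (h : IsLaurentApply t Y N)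
    (hN : IsNonprojIndec N) :
    orbits Y = (t.coeff.sum fun _ m => m) • {(npClass N hN).orbit} := by
  obtain ⟨Z, hZ, ⟨e⟩⟩ := h
  have h1 : ∀ a ∈ t.coeff.support, orbits (Z a) = {(npClass N hN).orbit} := by
    intro a ha
    have hin : InOmegaOrbit (Z a) N := ⟨a, hZ a ha⟩
    have hZa := hin.isNonprojIndec hN
    rw [orbits_of_isNonprojIndec hZa, (inOmegaOrbit_iff_orbit_eq hZa hN).1 hin]
  rw [orbits_congr e, orbits_biproduct, sum_sigma_eq t (fun a => orbits (Z a)),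
    Finsupp.sum, Finset.sum_smul]
  exact Finset.sum_congr rfl fun a ha => by rw [h1 a ha]

/-- The Laurent polynomial with a prescribed multiset of exponents, applied to an object. -/
theorem exists_isLaurentApply (m : Multiset ℤ) {N : C} (hN : IsNonprojIndec N) :
    ∃ Y : C, IsLaurentApply (AddMonoidAlgebra.ofCoeff (Multiset.toFinsupp m)) Y N ∧
      indecClasses Y = m.map fun a => ((omegaPerm C ^ a) (npClass N hN)).1 := by
  choose Z hZ using fun a : ℤ => ((omegaPerm C ^ a) (npClass N hN)).1.exists_rep
  refine ⟨_, ⟨Z, fun a _ => (isOmegaPow_iff a (q := npClass N hN) rfl).2 (hZ a),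
    ⟨Iso.refl _⟩⟩, ?_⟩
  rw [indecClasses_biproduct,
    sum_sigma_eq (AddMonoidAlgebra.ofCoeff (Multiset.toFinsupp m)) (fun a => indecClasses (Z a))]
  have h : ∀ a : ℤ, indecClasses (Z a) = {((omegaPerm C ^ a) (npClass N hN)).1} := by
    intro a
    rw [indecClasses_of_indecomposable (NPClass.isNonprojIndec _ (hZ a)).1, hZ a]
  rw [← Multiset.sum_map_singleton (m.map _), Multiset.map_map, Finset.sum_multiset_map_count]
  exact Finset.sum_congr rfl fun a _ => by rw [h a]; rfl

end Frobenius

/-! ### Tensoring with `M` on orbits, the matrix, and the recurrence. -/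

section Rep

variable {k : Type u} [Field k] {G : Type v} [Group G]

theorem IsSummand.tensor {M X Y : FDRep k G} (h : IsSummand X Y) :
    IsSummand (M ⊗ X) (M ⊗ Y) := by
  obtain ⟨Z, ⟨e⟩⟩ := h
  obtain ⟨e'⟩ := nonempty_tensor_biprod_iso M X Z
  exact ⟨M ⊗ Z, ⟨MonoidalCategory.whiskerLeftIso M e ≪≫ e'⟩⟩

variable [Fintype G]

theorem orbits_core (X : FDRep k G) : orbits (core X) = orbits X :=
  congrArg (Multiset.map NPClass.orbit)
    (npSummands_of_isCore (exists_isCore X).choose_spec)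

theorem coreSummandCount_eq (M : FDRep k G) (n : ℕ) :
    coreSummandCount M n = Multiset.card (orbits (tensorPow M n)) := by
  rw [orbits, Multiset.card_map]
  exact card_of_isCore (exists_isCore (tensorPow M n)).choose_spec
    (exists_indecDecomposition (core (tensorPow M n))).choose_spec

theorem orbits_tensor_biprod (M X Y : FDRep k G) :
    orbits (M ⊗ (X ⊞ Y)) = orbits (M ⊗ X) + orbits (M ⊗ Y) := by
  obtain ⟨e⟩ := nonempty_tensor_biprod_iso M X Y
  rw [orbits_congr e, orbits_biprod]

theorem orbits_tensor_omegaPerm (M : FDRep k G) {q : NPClass (FDRep k G)} {X Y : FDRep k G}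
    (hX : isoClass X = q.1) (hY : isoClass Y = (omegaPerm (FDRep k G) q).1) :
    orbits (M ⊗ Y) = orbits (M ⊗ X) :=
  orbits_of_stabSyz (((isSyzygy_iff hX).2 hY).stabSyz.tensor M)

theorem orbits_tensor_omegaPerm_pow (M : FDRep k G) (n : ℕ) {q : NPClass (FDRep k G)}
    {X : FDRep k G} (hX : isoClass X = q.1) : ∀ {Y : FDRep k G},
    isoClass Y = ((omegaPerm (FDRep k G) ^ n) q).1 → orbits (M ⊗ Y) = orbits (M ⊗ X) := by
  induction n with
  | zero =>
    intro Y hY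
    rw [pow_zero, Equiv.Perm.one_apply, ← hX, isoClass_eq_iff] at hY
    obtain ⟨e⟩ := hY
    exact orbits_congr (MonoidalCategory.whiskerLeftIso M e)
  | succ n ih =>
    intro Y hY
    obtain ⟨Z, hZ⟩ := ((omegaPerm (FDRep k G) ^ n) q).1.exists_rep
    rw [pow_succ', Equiv.Perm.mul_apply] at hY
    rw [orbits_tensor_omegaPerm M hZ hY, ih hZ]

theorem orbits_tensor_eq_of_orbit_eq (M : FDRep k G) {X Y : FDRep k G} (hX : IsNonprojIndec X)
    (hY : IsNonprojIndec Y) (h : (npClass X hX).orbit = (npClass Y hY).orbit) :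
    orbits (M ⊗ X) = orbits (M ⊗ Y) := by
  obtain ⟨a, ha⟩ := NPClass.orbit_eq_iff.1 h
  cases a with
  | ofNat n =>
    exact (orbits_tensor_omegaPerm_pow M n (q := npClass X hX) rfl
      (congrArg Subtype.val ha).symm).symm
  -- A negative power is moved to the other side, exchanging the roles of `X` and `Y`.
  | negSucc n =>
    rw [zpow_negSucc, Equiv.Perm.inv_eq_iff_eq] at ha
    exact orbits_tensor_omegaPerm_pow M (n + 1) (q := npClass Y hY) rfl (congrArg Subtype.val ha)

/-- The orbits occurring in `M ⊗ X` for `X` in a given orbit. -/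
def tensorOrbits (M : FDRep k G) (o : OmegaOrbit (FDRep k G)) :
    Multiset (OmegaOrbit (FDRep k G)) :=
  orbits (M ⊗ (NPClass.exists_rep o.out).choose)

theorem tensorOrbits_orbit (M : FDRep k G) {X : FDRep k G} (hX : IsNonprojIndec X) :
    tensorOrbits M (npClass X hX).orbit = orbits (M ⊗ X) := by
  obtain ⟨h, hq⟩ := (NPClass.exists_rep (npClass X hX).orbit.out).choose_spec
  refine orbits_tensor_eq_of_orbit_eq M h hX ?_
  rw [hq]
  exact Quotient.out_eq _

/-- Both sides are additive in `X` and vanish on projectives, so only non-projective indecomposables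
matter. There the left side depends only on the orbit. -/
theorem orbits_tensor (M X : FDRep k G) :
    orbits (M ⊗ X) = bindHom (tensorOrbits M) (orbits X) := by
  induction X using indec_induction with
  | hiso X Y e h =>
    rw [← orbits_congr e, ← h]
    exact orbits_congr (MonoidalCategory.whiskerLeftIso M e.symm)
  | hzero X h =>
    have hP : Projective X := Projective.of_iso (h.iso (isZero_zero _)).symm inferInstance
    rw [orbits_of_projective hP, orbits_of_projective (projective_tensor M hP), map_zero]
  | hcons A Z hA h =>
    rw [orbits_tensor_biprod, orbits_biprod, map_add, h]
    congr 1
    by_cases hP : Projective A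
    · rw [orbits_of_projective hP, orbits_of_projective (projective_tensor M hP), map_zero]
    · rw [orbits_of_isNonprojIndec ⟨hA, hP⟩, ← tensorOrbits_orbit M ⟨hA, hP⟩]
      exact (Multiset.singleton_bind _ _).symm

/-- The matrix of natural numbers obtained by setting `Ω = 1`. -/
def evalOneNat {s : ℕ} (T : Matrix (Fin s) (Fin s) ℕ[T;T⁻¹]) : Matrix (Fin s) (Fin s) ℕ :=
  T.map fun t => t.coeff.sum fun _ m => m

theorem evalOne_eq {s : ℕ} (T : Matrix (Fin s) (Fin s) ℕ[T;T⁻¹]) :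
    evalOne T = (Nat.castRingHom ℤ).mapMatrix (evalOneNat T) := by
  ext i j
  exact eval₂_one_eq (T i j)

theorem IsTensorMatrix.orbits_tensor {M : FDRep k G} {s : ℕ} {N : Fin s → FDRep k G}
    {T : Matrix (Fin s) (Fin s) ℕ[T;T⁻¹]} (hT : IsTensorMatrix M N T)
    (hN : ∀ i, IsNonprojIndec (N i)) (i : Fin s) :
    orbits (M ⊗ N i) = ∑ j, evalOneNat T i j • {(npClass (N j) (hN j)).orbit} := by
  obtain ⟨Y, hY, ⟨e⟩⟩ := hT i
  rw [← orbits_core, orbits_congr e, orbits_biproduct]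
  exact Finset.sum_congr rfl fun j _ => (hY j).orbits_eq (hN j)

theorem IsTensorMatrix.orbits_tensorPow {M : FDRep k G} {s : ℕ} {N : Fin s → FDRep k G}
    {T : Matrix (Fin s) (Fin s) ℕ[T;T⁻¹]} (hT : IsTensorMatrix M N T)
    (hN : ∀ i, IsNonprojIndec (N i)) {i₀ : Fin s} (e : N i₀ ≅ 𝟙_ (FDRep k G)) (n : ℕ) :
    orbits (tensorPow M n) =
      ∑ j, (evalOneNat T ^ n) i₀ j • {(npClass (N j) (hN j)).orbit} := by
  induction n with
  | zero =>
    change orbits (𝟙_ (FDRep k G)) = _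
    rw [← orbits_congr e, orbits_of_isNonprojIndec (hN i₀), Finset.sum_eq_single i₀]
    · simp
    · intro j _ hj
      rw [pow_zero, Matrix.one_apply_ne hj.symm, zero_smul]
    · exact fun h => absurd (Finset.mem_univ _) h
  | succ n ih =>
    change orbits (M ⊗ tensorPow M n) = _
    rw [OmegaAlg.orbits_tensor, ih, map_sum]
    have h : ∀ j, bindHom (tensorOrbits M)
        ((evalOneNat T ^ n) i₀ j • {(npClass (N j) (hN j)).orbit}) =
        ∑ l, ((evalOneNat T ^ n) i₀ j * evalOneNat T j l) •
          {(npClass (N l) (hN l)).orbit} := by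
      intro j
      have h1 : bindHom (tensorOrbits M) {(npClass (N j) (hN j)).orbit} = orbits (M ⊗ N j) := by
        rw [← tensorOrbits_orbit M (hN j)]
        exact Multiset.singleton_bind _ _
      rw [map_nsmul, h1, hT.orbits_tensor hN, Finset.smul_sum]
      exact Finset.sum_congr rfl fun l _ => (mul_smul _ _ _).symm
    rw [Finset.sum_congr rfl fun j _ => h j, Finset.sum_comm]
    refine Finset.sum_congr rfl fun l _ => ?_
    rw [pow_succ, Matrix.mul_apply, Finset.sum_smul]

theorem IsTensorMatrix.coreSummandCount_eq {M : FDRep k G} {s : ℕ} {N : Fin s → FDRep k G}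
    {T : Matrix (Fin s) (Fin s) ℕ[T;T⁻¹]} (hT : IsTensorMatrix M N T)
    (hN : ∀ i, IsNonprojIndec (N i)) {i₀ : Fin s} (e : N i₀ ≅ 𝟙_ (FDRep k G)) (n : ℕ) :
    (coreSummandCount M n : ℤ) = ∑ j, (evalOne T ^ n) i₀ j := by
  rw [OmegaAlg.coreSummandCount_eq, hT.orbits_tensorPow hN e n, evalOne_eq, ← map_pow, Multiset.card_sum, Nat.cast_sum]
  refine Finset.sum_congr rfl fun j _ => ?_
  rw [Multiset.card_nsmul, Multiset.card_singleton, mul_one]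
  rfl

theorem orbits_le_of_isSummand {X Y : FDRep k G} (h : IsSummand X Y) : orbits X ≤ orbits Y := by
  obtain ⟨Z, ⟨e⟩⟩ := h
  rw [orbits_congr e, orbits_biprod]
  exact Multiset.le_add_right _ _

/-- `N i` need not itself occur in a tensor power, but some `X` in its orbit is a summand of
`M^{⊗n}`. The orbits of `M ⊗ N i` are those of `M ⊗ X`, a summand of `M^{⊗(n+1)}`, hence are
represented. -/
theorem IsOrbitReps.exists_zpow {M : FDRep k G} {s : ℕ} {N : Fin s → FDRep k G}
    (hN : IsOrbitReps M N) (i : Fin s) {z : NPClass (FDRep k G)}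
    (hz : z ∈ npSummands (M ⊗ N i)) : ∃ x : Fin s × ℤ,
      (omegaPerm (FDRep k G) ^ x.2) (npClass (N x.1) (hN.nonprojIndec x.1)) = z := by
  obtain ⟨X, ⟨hX, n, hXn⟩, hXN⟩ := hN.represents i
  have h1 : z.orbit ∈ orbits (M ⊗ N i) := Multiset.mem_map_of_mem _ hz
  rw [← orbits_tensor_eq_of_orbit_eq M hX (hN.nonprojIndec i)
    ((inOmegaOrbit_iff_orbit_eq hX (hN.nonprojIndec i)).1 hXN)] at h1
  have h2 : z.orbit ∈ orbits (tensorPow M (n + 1)) :=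
    Multiset.mem_of_le (orbits_le_of_isSummand hXn.tensor) h1
  obtain ⟨z', hz', hzz⟩ := Multiset.mem_map.1 h2
  obtain ⟨A, hA, rfl, hs⟩ := exists_isSummand_of_mem_npSummands hz'
  obtain ⟨j, hj⟩ := hN.exhaustive A ⟨hA, n + 1, hs⟩
  rw [inOmegaOrbit_iff_orbit_eq hA (hN.nonprojIndec j), hzz, eq_comm, NPClass.orbit_eq_iff] at hj
  obtain ⟨a, ha⟩ := hj
  exact ⟨(j, a), ha⟩

/-- Each non-projective summand class of `M ⊗ N i` is written as some `Ω^a N_j`, and the `j`-th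
polynomial collects the exponents `a` assigned to `j`. For periodic `N_j` the exponent is not
unique; any choice works. -/
theorem IsOrbitReps.exists_row {M : FDRep k G} {s : ℕ} {N : Fin s → FDRep k G}
    (hN : IsOrbitReps M N) (i : Fin s) : ∃ t : Fin s → ℕ[T;T⁻¹], ∃ Y : Fin s → FDRep k G,
      (∀ j, IsLaurentApply (t j) (Y j) (N j)) ∧ Nonempty (core (M ⊗ N i) ≅ ⨁ Y) := by
  have hex : ∀ z : NPClass (FDRep k G), ∃ x : Fin s × ℤ, z ∈ npSummands (M ⊗ N i) →
      (omegaPerm (FDRep k G) ^ x.2) (npClass (N x.1) (hN.nonprojIndec x.1)) = z := by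
    intro z
    by_cases hz : z ∈ npSummands (M ⊗ N i)
    · obtain ⟨x, hx⟩ := hN.exists_zpow i hz
      exact ⟨x, fun _ => hx⟩
    -- A default value for classes that do not occur.
    · exact ⟨(i, 0), fun h => absurd h hz⟩
  choose x hx using hex
  choose Y hY hYc using fun j => exists_isLaurentApply
    (((npSummands (M ⊗ N i)).filter fun z => (x z).1 = j).map fun z => (x z).2)
    (hN.nonprojIndec j)
  refine ⟨_, Y, hY, nonempty_iso_of_indecClasses_eq ?_⟩
  have hc := (exists_isCore (M ⊗ N i)).choose_spec
  have h1 : indecClasses (core (M ⊗ N i)) = (npSummands (M ⊗ N i)).map Subtype.val := by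
    rw [← npSummands_of_isCore hc]
    exact (map_npSummands hc.2).symm
  have h2 : ∀ j, indecClasses (Y j) =
      ((npSummands (M ⊗ N i)).filter fun z => (x z).1 = j).map Subtype.val := by
    intro j
    rw [hYc, Multiset.map_map]
    refine Multiset.map_congr rfl fun z hz => ?_
    obtain ⟨hz1, rfl⟩ := Multiset.mem_filter.1 hz
    exact congrArg Subtype.val (hx z hz1)
  rw [h1, indecClasses_biproduct, Finset.sum_congr rfl fun j _ => h2 j]
  conv_lhs => rw [← sum_filter_eq (fun z => (x z).1) (npSummands (M ⊗ N i))]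
  exact map_sum (Multiset.mapAddMonoidHom Subtype.val) _ _

theorem IsOrbitReps.exists_isTensorMatrix {M : FDRep k G} {s : ℕ} {N : Fin s → FDRep k G}
    (hN : IsOrbitReps M N) : ∃ T, IsTensorMatrix M N T := by
  choose t Y hY h using hN.exists_row
  exact ⟨Matrix.of t, fun i => ⟨Y i, hY i, h i⟩⟩

theorem isTensorPowSummand_unit (M : FDRep k G) (h : (Fintype.card G : k) = 0) :
    IsTensorPowSummand M (𝟙_ (FDRep k G)) :=
  ⟨isNonprojIndec_unit h, 0, 0, ⟨isoBiprodZero (isZero_zero _)⟩⟩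

theorem IsOmegaAlgebraic.exists_isOrbitReps {M : FDRep k G} (hM : IsOmegaAlgebraic M)
    (h : (Fintype.card G : k) = 0) : ∃ (s : ℕ) (N : Fin s → FDRep k G) (i₀ : Fin s),
      IsOrbitReps M N ∧ N i₀ = 𝟙_ (FDRep k G) := by
  classical
  let O : Set (OmegaOrbit (FDRep k G)) :=
    {o | ∃ (X : FDRep k G) (hX : IsTensorPowSummand M X), (npClass X hX.1).orbit = o}
  have hO : O.Finite := by
    obtain ⟨s, N, hN, hex⟩ := hM
    refine (Set.finite_range fun i => (npClass (N i) (hN i)).orbit).subset ?_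
    rintro _ ⟨X, hX, rfl⟩
    obtain ⟨i, hi⟩ := hex X hX
    exact ⟨i, ((inOmegaOrbit_iff_orbit_eq hX.1 (hN i)).1 hi).symm⟩
  have h1 := isTensorPowSummand_unit M h
  let o₁ : O := ⟨(npClass _ h1.1).orbit, _, h1, rfl⟩
  -- The representative of the orbit of the trivial module is forced to be the trivial module
  -- itself.
  have hrep : ∀ o : O, ∃ (X : FDRep k G) (hX : IsTensorPowSummand M X),
      (npClass X hX.1).orbit = o.1 ∧ (o = o₁ → X = 𝟙_ (FDRep k G)) := by
    rintro ⟨_, X, hX, rfl⟩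
    by_cases ho : (npClass X hX.1).orbit = o₁.1
    · exact ⟨_, h1, ho.symm, fun _ => rfl⟩
    · exact ⟨X, hX, rfl, fun h => absurd (congrArg Subtype.val h) ho⟩
  choose R hR hRo hR1 using hrep
  have := hO.to_subtype
  let e := Finite.equivFin O
  refine ⟨Nat.card O, fun i => R (e.symm i), e o₁, ⟨fun i => (hR _).1, fun i => ?_,
    fun i j hij => ?_, fun X hX => ?_⟩, ?_⟩
  · exact ⟨_, hR (e.symm i), (inOmegaOrbit_iff_orbit_eq (hR _).1 (hR _).1).2 rfl⟩
  · rw [inOmegaOrbit_iff_orbit_eq (hR _).1 (hR _).1, hRo, hRo] at hij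
    exact e.symm.injective (Subtype.ext hij)
  · refine ⟨e ⟨_, X, hX, rfl⟩, (inOmegaOrbit_iff_orbit_eq hX.1 (hR _).1).2 ?_⟩
    rw [hRo, Equiv.symm_apply_apply]
  · exact hR1 _ (e.symm_apply_apply o₁)

theorem eventuallyLinearlyRecursive_sum_pow {R : Type w} [CommRing R] [Nontrivial R] {s : ℕ}
    (B : Matrix (Fin s) (Fin s) R) (i₀ : Fin s) :
    EventuallyLinearlyRecursive fun n => ∑ j, (B ^ n) i₀ j := by
  -- Cayley–Hamilton, solved for the leading power and multiplied by `B ^ n`; it holds from the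
  -- first term on.
  refine ⟨⟨s, fun i => -B.charpoly.coeff i⟩, 0, fun n => ?_⟩
  have h := B.aeval_self_charpoly
  rw [Polynomial.aeval_eq_sum_range, Matrix.charpoly_natDegree_eq_dim, Fintype.card_fin,
    Finset.sum_range_succ] at h
  have hlead : B.charpoly.coeff s = 1 := by
    have := B.charpoly_monic.coeff_natDegree
    rwa [Matrix.charpoly_natDegree_eq_dim, Fintype.card_fin] at this
  rw [hlead, one_smul, add_comm, ← eq_neg_iff_add_eq_zero, ← Fin.sum_univ_eq_sum_range] at h
  have h2 : B ^ (n + s) = ∑ i : Fin s, (-B.charpoly.coeff i) • B ^ (n + i) := by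
    rw [pow_add, h, mul_neg, Finset.mul_sum, ← Finset.sum_neg_distrib]
    refine Finset.sum_congr rfl fun i _ => ?_
    rw [mul_smul_comm, ← pow_add, neg_smul]
  change ∑ j, (B ^ (n + s)) i₀ j = ∑ i : Fin s, _ * ∑ j, (B ^ (n + i)) i₀ j
  rw [h2]
  simp only [Matrix.sum_apply, Matrix.smul_apply, smul_eq_mul, Finset.mul_sum]
  exact Finset.sum_comm

theorem coreSummandCount_eq_zero (h : (Fintype.card G : k) ≠ 0) (M : FDRep k G) (n : ℕ) :
    coreSummandCount M n = 0 := by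
  rw [coreSummandCount_eq, orbits_of_projective (projective_of_card_ne_zero h _),
    Multiset.card_zero]

end Rep

end OmegaAlg

end

theorem mainTheorem6 {k : Type u} [Field k] (p : ℕ) [Fact p.Prime] [CharP k p]
    {G : Type v} [Group G] [Finite G] (M : FDRep k G) (hM : OmegaAlg.IsOmegaAlgebraic M) :
    OmegaAlg.EventuallyLinearlyRecursive (fun n => (OmegaAlg.coreSummandCount M n : ℤ)) ∧
    (p ∣ Nat.card G → ∃ (s : ℕ) (N : Fin s → FDRep k G) (i₀ : Fin s),
      OmegaAlg.IsOrbitReps M N ∧ N i₀ = 𝟙_ (FDRep k G)) ∧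
    ∀ (s : ℕ) (N : Fin s → FDRep k G) (i₀ : Fin s),
      OmegaAlg.IsOrbitReps M N → Nonempty (N i₀ ≅ 𝟙_ (FDRep k G)) →
      (∃ T, OmegaAlg.IsTensorMatrix M N T) ∧
      ∀ T, OmegaAlg.IsTensorMatrix M N T → ∀ n : ℕ,
        (OmegaAlg.coreSummandCount M n : ℤ) = ∑ j, (OmegaAlg.evalOne T ^ n) i₀ j := by
  have := Fintype.ofFinite G
  have hcard : (Fintype.card G : k) = 0 ↔ p ∣ Nat.card G := by
    rw [CharP.cast_eq_zero_iff k p, Nat.card_eq_fintype_card]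
  refine ⟨?_, fun hp => hM.exists_isOrbitReps (hcard.2 hp), fun s N i₀ hN ⟨e⟩ =>
    ⟨hN.exists_isTensorMatrix, fun T hT n => hT.coreSummandCount_eq hN.nonprojIndec e n⟩⟩
  by_cases h : (Fintype.card G : k) = 0
  · obtain ⟨s, N, i₀, hN, h₀⟩ := hM.exists_isOrbitReps h
    obtain ⟨T, hT⟩ := hN.exists_isTensorMatrix
    rw [funext fun n => hT.coreSummandCount_eq hN.nonprojIndec (eqToIso h₀) n]
    exact OmegaAlg.eventuallyLinearlyRecursive_sum_pow _ i₀
  -- The recurrence of order zero says that the sequence vanishes.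
  · refine ⟨⟨0, Fin.elim0⟩, 0, fun n => ?_⟩
    simp [OmegaAlg.coreSummandCount_eq_zero h M]
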